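/- Let $k$ be a field. For a finite set $C$ of positive integers, let $\langle C\rangle\subseteq\mathbb{N}$ be the semigroup (containing $0$) generated by $C$; say that $C$ minimally generates the numerical semigroup $\langle C\rangle$ if $\gcd(C)=1$ and no proper subset of $C$ generates $\langle C\rangle$, and call $|C|$ the embedding dimension of $\langle C\rangle$. Let $R=k[x_c : c\in C]$, where $x_c$ has weight $c$, let $I_C$ be the kernel of the $k$-algebra homomorphism $R\to k[t]$, $x_c\mapsto t^c$, and let $k[C]\cong R/I_C$ be its image. The numerical semigroup $\langle C\rangle$ minimally generated by $C$ is called decomposable if $C$ is a disjoint union $C=k_1A\sqcup k_2B$, where $A$ and $B$ minimally generate numerical semigroups $\langle A\rangle$ and $\langle B\rangle$, and $k_1\in\langle B\rangle\setminus B$ and $k_2\in\langle A\rangle\setminus A$ are relatively prime positive integers. It is a complete intersection if $I_C$ is generated by a regular sequence, and an almost complete intersection if the minimal number of generators of $I_C$ is one more than the height of $I_C$. The Cohen–Macaulay type of $k[C]$ is $\dim_k \operatorname{Ext}^1_{k[C]}(k[C]/\mathfrak{m},k[C])$, where $\mathfrak{m}$ is the ideal of the elements of $k[C]$ with zero constant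 term. **Proposition.** Let $\langle C\rangle$ be a decomposable numerical semigroup of embedding dimension $4$, minimally generated by $C$. Then either $\langle C\rangle$ is a complete intersection, or $\langle C\rangle$ is an almost complete intersection, $k[C]$ has Cohen–Macaulay type $2$, and $k[C]$ has a minimal graded free resolution over $R$ of the form $$0\to R^2\to R^5\to R^4\to R\to k[C]\to 0 .$$ -/

import Mathlib

/-! Numerical semigroups, their semigroup rings, and minimal graded free resolutions. -/

namespace NumSemi

/-- The semigroup `⟨C⟩ ⊆ ℕ` (containing `0`) generated by a finite set `C` of natural numbers. -/
abbrev semigroup (C : Finset ℕ) : AddSubmonoid ℕ :=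
  AddSubmonoid.closure (C : Set ℕ)

/-- `C` is the minimal generating set of a numerical semigroup: `C` consists of positive integers
with greatest common divisor `1`, and no proper subset of `C` generates `⟨C⟩`.
The embedding dimension of `⟨C⟩` is then `C.card`. -/
structure IsMinimalGeneratingSet (C : Finset ℕ) : Prop where
  pos : ∀ c ∈ C, 0 < c
  gcd_eq_one : C.gcd id = 1
  minimal : ∀ D : Finset ℕ, D ⊂ C → semigroup D ≠ semigroup C

/-- The numerical semigroup `⟨C⟩` minimally generated by `C` is decomposable, that is, a gluing of
two numerical semigroups: `C` is the disjoint union of `k₁A` and `k₂B`, where `A` and `B` are the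
minimal generating sets of numerical semigroups, and `k₁ ∈ ⟨B⟩ ∖ B` and `k₂ ∈ ⟨A⟩ ∖ A` are
relatively prime positive integers. -/
def IsDecomposable (C : Finset ℕ) : Prop :=
  ∃ (A B : Finset ℕ) (k₁ k₂ : ℕ),
    IsMinimalGeneratingSet A ∧ IsMinimalGeneratingSet B ∧
    0 < k₁ ∧ 0 < k₂ ∧ Nat.Coprime k₁ k₂ ∧
    k₁ ∈ semigroup B ∧ k₁ ∉ B ∧ k₂ ∈ semigroup A ∧ k₂ ∉ A ∧
    Disjoint (A.image fun a => k₁ * a) (B.image fun b => k₂ * b) ∧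
    C = (A.image fun a => k₁ * a) ∪ (B.image fun b => k₂ * b)

section Ring

universe u

variable (k : Type u) [Field k] (C : Finset ℕ)

/-- The polynomial ring `R = k[x_c | c ∈ C]`, with one variable for each generator. -/
abbrev PolyRing : Type u := MvPolynomial C k

/-- The algebra homomorphism `φ_C : R → k[t]`, `x_c ↦ t ^ c`. -/
noncomputable def monomialMap : PolyRing k C →ₐ[k] Polynomial k :=
  MvPolynomial.aeval fun c : C => (Polynomial.X : Polynomial k) ^ (c : ℕ)

/-- The defining ideal `I_C = ker φ_C` of the monomial curve. -/
noncomputable def definingIdeal : Ideal (PolyRing k C) :=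
  RingHom.ker (monomialMap k C)

/-- The semigroup ring `k[C] = k[t ^ c | c ∈ C]`, the image of `φ_C`. -/
noncomputable def semigroupRing : Subalgebra k (Polynomial k) :=
  (monomialMap k C).range

/-- The irrelevant maximal ideal of `k[C]`: the elements with zero constant coefficient. -/
noncomputable def irrelevantIdeal : Ideal (semigroupRing k C) :=
  RingHom.ker ((Polynomial.constantCoeff (R := k)).comp
    (semigroupRing k C).val.toRingHom)

/-- The dimension over the residue field `A ⧸ 𝔪` of `Ext¹(A ⧸ 𝔪, A)`, for a maximal ideal `𝔪`; it
is the length of this `A`-module, since `𝔪` annihilates it. When `A` localized at `𝔪` is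
Cohen-Macaulay of Krull dimension `1`, this is its Cohen-Macaulay type. -/
noncomputable def typeAt {A : Type u} [CommRing A] (𝔪 : Ideal A) : ℕ∞ :=
  Module.length A
    (CategoryTheory.Abelian.Ext (ModuleCat.of A (A ⧸ 𝔪)) (ModuleCat.of A A) 1)

/-- The Cohen-Macaulay type of `k[C]`, which is a Cohen-Macaulay ring of Krull dimension `1`. -/
noncomputable def cohenMacaulayType : ℕ∞ :=
  typeAt (irrelevantIdeal k C)

/-- `k[C]` is a complete intersection: `I_C` is generated by a regular sequence. -/
def IsCompleteIntersection : Prop :=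
  ∃ rs : List (PolyRing k C),
    RingTheory.Sequence.IsRegular (PolyRing k C) rs ∧ Ideal.ofList rs = definingIdeal k C

/-- `k[C]` is an almost complete intersection: the minimal number of generators of `I_C` is one
more than the height of `I_C`. -/
def IsAlmostCompleteIntersection : Prop :=
  ((definingIdeal k C).spanFinrank : ℕ∞) = (definingIdeal k C).height + 1

/-- A polynomial of `R` is homogeneous of degree `n` when each variable `x_c` has weight `c`. -/
def IsHomogeneous (f : PolyRing k C) (n : ℕ) : Prop :=
  MvPolynomial.IsWeightedHomogeneous (fun c : C => (c : ℕ)) f n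

/-- A minimal graded free resolution
`⋯ → R ^ β 2 → R ^ β 1 → R ^ β 0 → R ⧸ I_C → 0` of `k[C] ≃ R ⧸ I_C` with ranks `β`, where the
variable `x_c` has weight `c`. The basis vector `e_j` of `R ^ β i` has degree `deg i j`, the
entries of the differentials are homogeneous of the degrees that make the differentials of degree
`0`, and minimality says that they lie in the ideal generated by the variables. -/
structure MinimalGradedFreeResolution (β : ℕ → ℕ) where
  /-- The degrees of the basis vectors. -/
  deg : ∀ i, Fin (β i) → ℕ
  /-- The differentials. -/
  d : ∀ i, (Fin (β (i + 1)) → PolyRing k C) →ₗ[PolyRing k C] (Fin (β i) → PolyRing k C)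
  /-- The augmentation. -/
  ε : (Fin (β 0) → PolyRing k C) →ₗ[PolyRing k C] (PolyRing k C ⧸ definingIdeal k C)
  surjective_ε : Function.Surjective ε
  exact_ε : Function.Exact (d 0) ε
  exact_d : ∀ i, Function.Exact (d (i + 1)) (d i)
  homogeneous_ε : ∀ j, ∃ f : PolyRing k C, IsHomogeneous k C f (deg 0 j) ∧
    ε (Pi.single j 1) = Ideal.Quotient.mk (definingIdeal k C) f
  homogeneous_d : ∀ i j r, d i (Pi.single j 1) r ≠ 0 →
    ∃ n, n + deg i r = deg (i + 1) j ∧ IsHomogeneous k C (d i (Pi.single j 1) r) n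
  minimal : ∀ i v r, d i v r ∈ Ideal.span (Set.range (MvPolynomial.X : C → PolyRing k C))

end Ring

end NumSemi

/-! Since |A| + |B| = 4, the gluing is of shape 1+3 or 2+2 up to exchanging the parts, and a part
with one generator is {1}. Gluing adds one binomial to the relations of the two parts, equating two
monomials of weight k₁k₂. In shape 2+2 each part has a single binomial relation, so I_C has three
generators. In shape 1+3 with B = {b₁, b₂, b₃}, Herzog's dichotomy `gluing_or_herzogData` decides:
either some b_l, multiplied by the gcd of the other two generators, lies in the semigroup of those
two, and B has two binomial relations; or the minimal relations of B have six positive exponents,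
and its ideal is generated by the maximal minors of a 2 × 3 matrix of monomials
(`toricIdeal_eq_span_minors`).

Complete intersections come from a chain of toric ideals of weights in ℕ³, ℕ² and ℕ. Each is prime,
and `toricIdeal_gluing` shows that each identification of weights costs one binomial. A binomial
outside the preceding prime is a nonzerodivisor modulo it, so the three binomials form a regular
sequence.

In the determinantal case I_C = (f₁, f₂, f₃, g), with the fᵢ the minors and g the gluing binomial, a
nonzerodivisor modulo the prime (f₁, f₂, f₃). Hilbert–Burch resolves the minors, and tensoring with
the Koszul complex of g gives ranks 1, 4, 5, 2. All matrix entries lie in the ideal of the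
variables, so the resolution is minimal and I_C needs four generators, while its height is 3
(`height_definingIdeal`).

For the type, Ext¹(A/𝔪, A) is Hom(𝔪, A) modulo multiplications, which is ((t) : 𝔪)/(t) for nonzero t
∈ 𝔪. With t a monomial this counts maximal elements of an Apéry set (`cohenMacaulayType_eq_card`).
For a Herzog presentation they are the two corners of a staircase, and the gluing carries them over
by v ↦ k₂v + (k₂ − 1)k₁ (`maximal_apery_gluing_iff`). -/

namespace NumSemi

/-! ### Herzog's dichotomy for three generators -/

/-- The exponents of Herzog's presentation of a numerical semigroup on three generators that is not a
complete intersection. -/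
structure HerzogData (b₁ b₂ b₃ : ℕ) where
  (r₁₂ r₁₃ r₂₁ r₂₃ r₃₁ r₃₂ : ℕ)
  pos₁₂ : 0 < r₁₂
  pos₁₃ : 0 < r₁₃
  pos₂₁ : 0 < r₂₁
  pos₂₃ : 0 < r₂₃
  pos₃₁ : 0 < r₃₁
  pos₃₂ : 0 < r₃₂
  rel₁ : (r₂₁ + r₃₁) * b₁ = r₁₂ * b₂ + r₁₃ * b₃
  rel₂ : (r₁₂ + r₃₂) * b₂ = r₂₁ * b₁ + r₂₃ * b₃
  rel₃ : (r₁₃ + r₂₃) * b₃ = r₃₁ * b₁ + r₃₂ * b₂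
  min₁ : ∀ c r s, 0 < c → c * b₁ = r * b₂ + s * b₃ → r₂₁ + r₃₁ ≤ c
  min₂ : ∀ c r s, 0 < c → c * b₂ = r * b₁ + s * b₃ → r₁₂ + r₃₂ ≤ c
  min₃ : ∀ c r s, 0 < c → c * b₃ = r * b₁ + s * b₂ → r₁₃ + r₂₃ ≤ c

lemma exists_minimal_relation {b₁ b₂ b₃ : ℕ} (h₂ : 0 < b₂) :
    ∃ c r s, 0 < c ∧ c * b₁ = r * b₂ + s * b₃ ∧
      ∀ c' r' s', 0 < c' → c' * b₁ = r' * b₂ + s' * b₃ → c ≤ c' := by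
  classical
  have H : ∃ c, 0 < c ∧ ∃ r s, c * b₁ = r * b₂ + s * b₃ :=
    ⟨b₂, h₂, b₁, 0, by ring⟩
  obtain ⟨h, r, s, hrs⟩ := Nat.find_spec H
  exact ⟨Nat.find H, r, s, h, hrs, fun c' r' s' hc' h' => Nat.find_min' H ⟨hc', r', s', h'⟩⟩

/-- If a minimal relation for `b₁` involves only `b₂`, then the semigroup is a gluing. -/
lemma gluing_of_minimal_relation {b₁ b₂ b₃ c r : ℕ} (h₁ : 0 < b₁) (h₃ : 0 < b₃)
    (hc : 0 < c) (hr : c * b₁ = r * b₂)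
    (hmin : ∀ c' r' s', 0 < c' → c' * b₁ = r' * b₂ + s' * b₃ → c ≤ c') :
    ∃ p q, Nat.gcd b₁ b₂ * b₃ = p * b₁ + q * b₂ := by
  have hd : 0 < Nat.gcd b₁ b₂ := Nat.gcd_pos_of_pos_left _ h₁
  -- an integral representation, with the coefficient of `b₁` reduced modulo `c`
  obtain ⟨x, y, hxy⟩ : ∃ x y : ℤ, (Nat.gcd b₁ b₂ * b₃ : ℤ) = x * b₁ + y * b₂ := by
    refine ⟨Nat.gcdA b₁ b₂ * b₃, Nat.gcdB b₁ b₂ * b₃, ?_⟩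
    rw [Nat.gcd_eq_gcd_ab]; ring
  have hcz : (0 : ℤ) < c := by exact_mod_cast hc
  have hrz : (c * b₁ : ℤ) = r * b₂ := by exact_mod_cast hr
  have h0 := Int.emod_nonneg x hcz.ne'
  have h1 := Int.emod_lt_of_pos x hcz
  have hx := Int.mul_ediv_add_emod x c
  obtain ⟨p, hp⟩ := Int.eq_ofNat_of_zero_le h0
  have key : (Nat.gcd b₁ b₂ * b₃ : ℤ) = p * b₁ + (y + r * (x / c)) * b₂ := by
    rw [hxy]
    have : x = p + c * (x / c) := by rw [← hp]; linarith
    calc x * b₁ + y * b₂ = (p + c * (x / c)) * b₁ + y * b₂ := by rw [← this]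
      _ = p * b₁ + (x / c) * (c * b₁) + y * b₂ := by ring
      _ = _ := by rw [hrz]; ring
  rcases le_or_gt 0 (y + r * (x / c)) with hq | hq
  · obtain ⟨q, hq⟩ := Int.eq_ofNat_of_zero_le hq
    rw [hq] at key
    exact ⟨p, q, by exact_mod_cast key⟩
  -- A negative coefficient of b₂ moves to the other side and gives p b₁ = q b₂ + d b₃ with 0 < p <
  -- c, against the minimality of c.
  · exfalso
    obtain ⟨q, hq'⟩ := Int.eq_ofNat_of_zero_le (a := -(y + r * (x / c))) (by linarith)
    have key2 : p * b₁ = q * b₂ + Nat.gcd b₁ b₂ * b₃ := by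
      have : (p * b₁ : ℤ) = q * b₂ + Nat.gcd b₁ b₂ * b₃ := by
        rw [key, show (q : ℤ) = -(y + r * (x / c)) from hq'.symm]; ring
      exact_mod_cast this
    have hp0 : 0 < p := by
      rcases Nat.eq_zero_or_pos p with h | h
      · subst h
        have := Nat.mul_pos hd h₃
        omega
      · exact h
    have := hmin p q _ hp0 key2
    have : (p : ℤ) < c := by rw [← show x % c = p from hp]; exact h1
    omega

/-- If r₂₁ ≥ c₁, adding the two relations cancels c₁b₁ and leaves (c₂ − r₁₂)b₂ as a combination of
b₁ and b₃. As r₁₂ > 0, its coefficient is below the minimal c₂. -/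
lemma coeff_lt {b₁ b₂ b₃ c₁ c₂ r₁₂ r₁₃ r₂₁ r₂₃ : ℕ} (h₃ : 0 < b₃)
    (h₁₂ : 0 < r₁₂) (h₁₃ : 0 < r₁₃)
    (e₁ : c₁ * b₁ = r₁₂ * b₂ + r₁₃ * b₃) (e₂ : c₂ * b₂ = r₂₁ * b₁ + r₂₃ * b₃)
    (m₂ : ∀ c r s, 0 < c → c * b₂ = r * b₁ + s * b₃ → c₂ ≤ c) (hc₂ : 0 < c₂) : r₂₁ < c₁ := by
  by_contra! h
  obtain ⟨t, rfl⟩ := Nat.exists_eq_add_of_le h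
  have e : c₂ * b₂ = r₁₂ * b₂ + t * b₁ + (r₁₃ + r₂₃) * b₃ := by linarith
  have hpos : 0 < r₁₃ * b₃ := Nat.mul_pos h₁₃ h₃
  have hlt : r₁₂ < c₂ := by
    have : r₁₂ * b₂ < c₂ * b₂ := by rw [e, add_mul]; omega
    exact lt_of_mul_lt_mul_right this (Nat.zero_le _)
  obtain ⟨d, rfl⟩ := Nat.exists_eq_add_of_lt hlt
  have := m₂ (d + 1) t (r₁₃ + r₂₃) (by omega) (by linarith)
  omega

/-- A numerical semigroup on three generators is a gluing or has a Herzog presentation. -/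
theorem gluing_or_herzogData {b₁ b₂ b₃ : ℕ} (h₁ : 0 < b₁) (h₂ : 0 < b₂) (h₃ : 0 < b₃) :
    (∃ p q, Nat.gcd b₁ b₂ * b₃ = p * b₁ + q * b₂) ∨
    (∃ p q, Nat.gcd b₁ b₃ * b₂ = p * b₁ + q * b₃) ∨
    (∃ p q, Nat.gcd b₂ b₃ * b₁ = p * b₂ + q * b₃) ∨ Nonempty (HerzogData b₁ b₂ b₃) := by
  by_contra! ⟨n₃, n₂, n₁, hn⟩
  obtain ⟨c₁, r₁₂, r₁₃, hc₁, e₁, m₁⟩ := exists_minimal_relation (b₁ := b₁) (b₃ := b₃) h₂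
  obtain ⟨c₂, r₂₁, r₂₃, hc₂, e₂, m₂⟩ := exists_minimal_relation (b₁ := b₂) (b₃ := b₃) h₁
  obtain ⟨c₃, r₃₁, r₃₂, hc₃, e₃, m₃⟩ := exists_minimal_relation (b₁ := b₃) (b₃ := b₂) h₁
  have m₁' : ∀ c r s, 0 < c → c * b₁ = r * b₃ + s * b₂ → c₁ ≤ c :=
    fun c r s hc h => m₁ c s r hc (by rw [h, add_comm])
  have m₂' : ∀ c r s, 0 < c → c * b₂ = r * b₃ + s * b₁ → c₂ ≤ c :=
    fun c r s hc h => m₂ c s r hc (by rw [h, add_comm])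
  have m₃' : ∀ c r s, 0 < c → c * b₃ = r * b₂ + s * b₁ → c₃ ≤ c :=
    fun c r s hc h => m₃ c s r hc (by rw [h, add_comm])
  -- A vanishing coefficient leaves a minimal relation between two generators only, which is one of
  -- the excluded gluings.
  have p₁₃ : 0 < r₁₃ := by
    by_contra! h
    obtain rfl : r₁₃ = 0 := by omega
    obtain ⟨p, q, h⟩ := gluing_of_minimal_relation h₁ h₃ hc₁ (by linarith) m₁
    exact n₃ p q h
  have p₁₂ : 0 < r₁₂ := by
    by_contra! h
    obtain rfl : r₁₂ = 0 := by omega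
    obtain ⟨p, q, h⟩ := gluing_of_minimal_relation h₁ h₂ hc₁ (r := r₁₃) (by linarith) m₁'
    exact n₂ p q h
  have p₂₃ : 0 < r₂₃ := by
    by_contra! h
    obtain rfl : r₂₃ = 0 := by omega
    obtain ⟨p, q, h⟩ := gluing_of_minimal_relation h₂ h₃ hc₂ (by linarith) m₂
    exact n₃ q p (by rw [Nat.gcd_comm, h, add_comm])
  have p₂₁ : 0 < r₂₁ := by
    by_contra! h
    obtain rfl : r₂₁ = 0 := by omega
    obtain ⟨p, q, h⟩ := gluing_of_minimal_relation h₂ h₁ hc₂ (r := r₂₃) (by linarith) m₂'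
    exact n₁ p q h
  have p₃₂ : 0 < r₃₂ := by
    by_contra! h
    obtain rfl : r₃₂ = 0 := by omega
    obtain ⟨p, q, h⟩ := gluing_of_minimal_relation h₃ h₂ hc₃ (by linarith) m₃
    exact n₂ q p (by rw [Nat.gcd_comm, h, add_comm])
  have p₃₁ : 0 < r₃₁ := by
    by_contra! h
    obtain rfl : r₃₁ = 0 := by omega
    obtain ⟨p, q, h⟩ := gluing_of_minimal_relation h₃ h₁ hc₃ (r := r₃₂) (by linarith) m₃'
    exact n₁ q p (by rw [Nat.gcd_comm, h, add_comm])
  -- These strict bounds make the differences such as c₁ − r₂₁ below genuine natural numbers.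
  have l₂₁ : r₂₁ < c₁ := coeff_lt h₃ p₁₂ p₁₃ e₁ e₂ m₂ hc₂
  have l₃₁ : r₃₁ < c₁ := coeff_lt h₂ p₁₃ p₁₂ (by rw [e₁, add_comm]) e₃ m₃ hc₃
  have l₁₂ : r₁₂ < c₂ := coeff_lt h₃ p₂₁ p₂₃ e₂ e₁ m₁ hc₁
  have l₃₂ : r₃₂ < c₂ := coeff_lt h₁ p₂₃ p₂₁ (by rw [e₂, add_comm]) (by rw [e₃, add_comm]) m₃' hc₃
  have l₁₃ : r₁₃ < c₃ := coeff_lt h₂ p₃₁ p₃₂ e₃ (by rw [e₁, add_comm]) m₁' hc₁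
  have l₂₃ : r₂₃ < c₃ := coeff_lt h₁ p₃₂ p₃₁ (by rw [e₃, add_comm]) (by rw [e₂, add_comm]) m₂' hc₂
  -- The sum of two minimal relations, rearranged, is a relation for the third generator, so its
  -- minimal coefficient is at most r₁₃ + r₂₃.
  have g₃ : c₃ ≤ r₁₃ + r₂₃ := by
    refine m₃ _ (c₁ - r₂₁) (c₂ - r₁₂) (by omega) ?_
    zify [l₂₁.le, l₁₂.le]
    zify at e₁ e₂
    linear_combination -e₁ - e₂
  have g₂ : c₂ ≤ r₁₂ + r₃₂ := by
    refine m₂ _ (c₁ - r₃₁) (c₃ - r₁₃) (by omega) ?_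
    zify [l₃₁.le, l₁₃.le]
    zify at e₁ e₃
    linear_combination -e₁ - e₃
  have g₁ : c₁ ≤ r₂₁ + r₃₁ := by
    refine m₁ _ (c₂ - r₃₂) (c₃ - r₂₃) (by omega) ?_
    zify [l₃₂.le, l₂₃.le]
    zify at e₂ e₃
    linear_combination -e₂ - e₃
  obtain ⟨d₁, hd₁⟩ := Nat.exists_eq_add_of_le g₁
  obtain ⟨d₂, hd₂⟩ := Nat.exists_eq_add_of_le g₂
  obtain ⟨d₃, hd₃⟩ := Nat.exists_eq_add_of_le g₃
  -- The sum of all three relations leaves no room for slack: the three inequalities just found are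
  -- equalities.
  have hsum : d₁ * b₁ + d₂ * b₂ + d₃ * b₃ = 0 := by
    have : (r₂₁ + r₃₁) * b₁ + (r₁₂ + r₃₂) * b₂ + (r₁₃ + r₂₃) * b₃
        = c₁ * b₁ + c₂ * b₂ + c₃ * b₃ := by rw [e₁, e₂, e₃]; ring
    rw [hd₁, hd₂, hd₃] at this
    linarith
  have z₁ : d₁ = 0 := by
    have : d₁ * b₁ = 0 := by omega
    exact (Nat.mul_eq_zero.1 this).resolve_right h₁.ne'
  have z₂ : d₂ = 0 := by
    have : d₂ * b₂ = 0 := by omega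
    exact (Nat.mul_eq_zero.1 this).resolve_right h₂.ne'
  have z₃ : d₃ = 0 := by
    have : d₃ * b₃ = 0 := by omega
    exact (Nat.mul_eq_zero.1 this).resolve_right h₃.ne'
  obtain rfl : c₁ = r₂₁ + r₃₁ := by omega
  obtain rfl : c₂ = r₁₂ + r₃₂ := by omega
  obtain rfl : c₃ = r₁₃ + r₂₃ := by omega
  exact hn.elim ⟨r₁₂, r₁₃, r₂₁, r₂₃, r₃₁, r₃₂, p₁₂, p₁₃, p₂₁, p₂₃, p₃₁, p₃₂, e₁, e₂, e₃, m₁, m₂, m₃⟩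

/-! ### Congruences and Apéry sets from a Herzog presentation -/

namespace HerzogData

variable {b₁ b₂ b₃ : ℕ}

/-- Exponents of the same weight are congruent modulo the three relations. -/
theorem con_of_weight_eq (h : HerzogData b₁ b₂ b₃) (h₁ : 0 < b₁) (h₂ : 0 < b₂) (h₃ : 0 < b₃)
    (r : AddCon (ℕ × ℕ × ℕ)) (e₁ : r (h.r₂₁ + h.r₃₁, 0, 0) (0, h.r₁₂, h.r₁₃))
    (e₂ : r (0, h.r₁₂ + h.r₃₂, 0) (h.r₂₁, 0, h.r₂₃))
    (e₃ : r (0, 0, h.r₁₃ + h.r₂₃) (h.r₃₁, h.r₃₂, 0)) (N : ℕ) :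
    ∀ a b c a' b' c', a * b₁ + b * b₂ + c * b₃ = N → a' * b₁ + b' * b₂ + c' * b₃ = N →
      r (a, b, c) (a', b', c') := by
  induction N using Nat.strong_induction_on with
  | _ N ih =>
    -- A variable common to both monomials is cancelled, and the induction hypothesis applies in
    -- smaller weight.
    have shared₁ : ∀ a b c a' b' c', 0 < a → 0 < a' → a * b₁ + b * b₂ + c * b₃ = N →
        a' * b₁ + b' * b₂ + c' * b₃ = N → r (a, b, c) (a', b', c') := by
      rintro (_ | a) b c (_ | a') b' c' ha ha' hw hw'
      any_goals omega
      have := ih (a * b₁ + b * b₂ + c * b₃) (by linarith) a b c a' b' c' rfl (by linarith)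
      exact r.add this (r.refl (1, 0, 0))
    have shared₂ : ∀ a b c a' b' c', 0 < b → 0 < b' → a * b₁ + b * b₂ + c * b₃ = N →
        a' * b₁ + b' * b₂ + c' * b₃ = N → r (a, b, c) (a', b', c') := by
      rintro a (_ | b) c a' (_ | b') c' ha ha' hw hw'
      any_goals omega
      have := ih (a * b₁ + b * b₂ + c * b₃) (by linarith) a b c a' b' c' rfl (by linarith)
      exact r.add this (r.refl (0, 1, 0))
    have shared₃ : ∀ a b c a' b' c', 0 < c → 0 < c' → a * b₁ + b * b₂ + c * b₃ = N →
        a' * b₁ + b' * b₂ + c' * b₃ = N → r (a, b, c) (a', b', c') := by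
      rintro a b (_ | c) a' b' (_ | c') ha ha' hw hw'
      any_goals omega
      have := ih (a * b₁ + b * b₂ + c * b₃) (by linarith) a b c a' b' c' rfl (by linarith)
      exact r.add this (r.refl (0, 0, 1))
    rcases Nat.eq_zero_or_pos N with rfl | hN
    · intro a b c a' b' c' hw hw'
      simp only [Nat.add_eq_zero_iff, mul_eq_zero, h₁.ne', h₂.ne', h₃.ne', or_false] at hw hw'
      obtain ⟨⟨rfl, rfl⟩, rfl⟩ := hw
      obtain ⟨⟨rfl, rfl⟩, rfl⟩ := hw'
      exact r.refl _
    -- A pure power equal in weight to a monomial in the other variables has exponent at least the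
    -- minimal one. One use of its relation introduces both other variables, one of which occurs on
    -- the other side.
    have pure₁ : ∀ a b c, a * b₁ = N → b * b₂ + c * b₃ = N → r (a, 0, 0) (0, b, c) := by
      intro a b c hw hw'
      have ha : 0 < a := Nat.pos_of_ne_zero (by rintro rfl; omega)
      obtain ⟨t, rfl⟩ := Nat.exists_eq_add_of_le (h.min₁ a b c ha (by omega))
      have hs : r (h.r₂₁ + h.r₃₁ + t, 0, 0) (t, h.r₁₂, h.r₁₃) := by
        simpa using r.add e₁ (r.refl (t, 0, 0))
      have hw2 : t * b₁ + h.r₁₂ * b₂ + h.r₁₃ * b₃ = N := by rw [← hw, add_mul, h.rel₁]; ring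
      refine r.trans hs ?_
      rcases Nat.eq_zero_or_pos b with rfl | hb
      · have hc : 0 < c := Nat.pos_of_ne_zero (by rintro rfl; omega)
        exact shared₃ _ _ _ _ _ _ h.pos₁₃ hc hw2 (by omega)
      · exact shared₂ _ _ _ _ _ _ h.pos₁₂ hb hw2 (by omega)
    have pure₂ : ∀ a b c, b * b₂ = N → a * b₁ + c * b₃ = N → r (0, b, 0) (a, 0, c) := by
      intro a b c hw hw'
      have ha : 0 < b := Nat.pos_of_ne_zero (by rintro rfl; omega)
      obtain ⟨t, rfl⟩ := Nat.exists_eq_add_of_le (h.min₂ b a c ha (by omega))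
      have hs : r (0, h.r₁₂ + h.r₃₂ + t, 0) (h.r₂₁, t, h.r₂₃) := by
        simpa using r.add e₂ (r.refl (0, t, 0))
      have hw2 : h.r₂₁ * b₁ + t * b₂ + h.r₂₃ * b₃ = N := by
        rw [← hw, add_mul (h.r₁₂ + h.r₃₂), h.rel₂]; ring
      refine r.trans hs ?_
      rcases Nat.eq_zero_or_pos a with rfl | hb
      · have hc : 0 < c := Nat.pos_of_ne_zero (by rintro rfl; omega)
        exact shared₃ _ _ _ _ _ _ h.pos₂₃ hc hw2 (by omega)
      · exact shared₁ _ _ _ _ _ _ h.pos₂₁ hb hw2 (by omega)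
    have pure₃ : ∀ a b c, c * b₃ = N → a * b₁ + b * b₂ = N → r (0, 0, c) (a, b, 0) := by
      intro a b c hw hw'
      have ha : 0 < c := Nat.pos_of_ne_zero (by rintro rfl; omega)
      obtain ⟨t, rfl⟩ := Nat.exists_eq_add_of_le (h.min₃ c a b ha (by omega))
      have hs : r (0, 0, h.r₁₃ + h.r₂₃ + t) (h.r₃₁, h.r₃₂, t) := by
        simpa using r.add e₃ (r.refl (0, 0, t))
      have hw2 : h.r₃₁ * b₁ + h.r₃₂ * b₂ + t * b₃ = N := by
        rw [← hw, add_mul (h.r₁₃ + h.r₂₃), h.rel₃]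
      refine r.trans hs ?_
      rcases Nat.eq_zero_or_pos a with rfl | hb
      · have hc : 0 < b := Nat.pos_of_ne_zero (by rintro rfl; omega)
        exact shared₂ _ _ _ _ _ _ h.pos₃₂ hc hw2 (by omega)
      · exact shared₁ _ _ _ _ _ _ h.pos₃₁ hb hw2 (by omega)
    intro a b c a' b' c' hw hw'
    by_cases s₁ : 0 < a ∧ 0 < a'
    · exact shared₁ _ _ _ _ _ _ s₁.1 s₁.2 hw hw'
    by_cases s₂ : 0 < b ∧ 0 < b'
    · exact shared₂ _ _ _ _ _ _ s₂.1 s₂.2 hw hw'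
    by_cases s₃ : 0 < c ∧ 0 < c'
    · exact shared₃ _ _ _ _ _ _ s₃.1 s₃.2 hw hw'
    -- With disjoint supports among three variables, one side is a pure power, or else one side is
    -- trivial, which N > 0 excludes.
    have t₁ : a = 0 ∨ a' = 0 := by omega
    have t₂ : b = 0 ∨ b' = 0 := by omega
    have t₃ : c = 0 ∨ c' = 0 := by omega
    rcases t₁ with rfl | rfl <;> rcases t₂ with rfl | rfl <;> rcases t₃ with rfl | rfl
    · omega
    · exact pure₃ _ _ _ (by omega) (by omega)
    · exact pure₂ _ _ _ (by omega) (by omega)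
    · exact r.symm (pure₁ _ _ _ (by omega) (by omega))
    · exact pure₁ _ _ _ (by omega) (by omega)
    · exact r.symm (pure₂ _ _ _ (by omega) (by omega))
    · exact r.symm (pure₃ _ _ _ (by omega) (by omega))
    · omega

/-- The monomials in the last two variables which are divisible by the first variable modulo the
relations. -/
lemma exists_add_iff (h : HerzogData b₁ b₂ b₃) (h₁ : 0 < b₁) (h₂ : 0 < b₂) (h₃ : 0 < b₃) (i j : ℕ) :
    (∃ x y z, i * b₂ + j * b₃ = b₁ + (x * b₁ + y * b₂ + z * b₃)) ↔
      h.r₁₂ + h.r₃₂ ≤ i ∨ h.r₁₃ + h.r₂₃ ≤ j ∨ (h.r₁₂ ≤ i ∧ h.r₁₃ ≤ j) := by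
  constructor
  · rintro ⟨x, y, z, e⟩
    -- Common multiples of b₂ and b₃ are cancelled. If one of them survives on the right, the other
    -- alone satisfies a relation and reaches its minimal exponent; otherwise (x + 1)b₁ = i b₂ + j
    -- b₃ is compared with `rel₁`.
    rcases lt_or_ge i y with hy | hy
    · right; left
      obtain ⟨y, rfl⟩ := Nat.exists_eq_add_of_le hy.le
      have hz : z < j := by
        by_contra! hz
        nlinarith [Nat.mul_le_mul_right b₃ hz]
      obtain ⟨j, rfl⟩ := Nat.exists_eq_add_of_lt hz
      have := h.min₃ (j + 1) (x + 1) y (by omega) (by linarith)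
      omega
    obtain ⟨i, rfl⟩ := Nat.exists_eq_add_of_le hy
    rcases lt_or_ge j z with hz | hz
    · left
      obtain ⟨z, rfl⟩ := Nat.exists_eq_add_of_le hz.le
      have hi : 0 < i := Nat.pos_of_ne_zero (by rintro rfl; nlinarith)
      have := h.min₂ i (x + 1) z hi (by linarith)
      omega
    obtain ⟨j, rfl⟩ := Nat.exists_eq_add_of_le hz
    have e' : (x + 1) * b₁ = i * b₂ + j * b₃ := by linarith
    obtain ⟨t, ht⟩ := Nat.exists_eq_add_of_le (h.min₁ (x + 1) i j (by omega) e')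
    rw [ht, add_mul, h.rel₁] at e'
    rcases lt_or_ge i h.r₁₂ with hi | hi
    · right; left
      obtain ⟨d, hd⟩ := Nat.exists_eq_add_of_le hi.le
      rw [hd] at e'
      have hj : h.r₁₃ < j := by
        by_contra! hj
        nlinarith [Nat.mul_le_mul_right b₃ hj]
      obtain ⟨j, rfl⟩ := Nat.exists_eq_add_of_lt hj
      have := h.min₃ (j + 1) t d (by omega) (by linarith)
      omega
    rcases lt_or_ge j h.r₁₃ with hj | hj
    · left
      obtain ⟨d, hd⟩ := Nat.exists_eq_add_of_le hj.le
      rw [hd] at e'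
      obtain ⟨i, rfl⟩ := Nat.exists_eq_add_of_le hi
      have hi : 0 < i := Nat.pos_of_ne_zero (by rintro rfl; nlinarith)
      have := h.min₂ i t d hi (by linarith)
      omega
    · omega
  · rintro (hi | hj | ⟨hi, hj⟩)
    · obtain ⟨t, rfl⟩ := Nat.exists_eq_add_of_le hi
      obtain ⟨s, hs⟩ := Nat.exists_eq_add_of_lt h.pos₂₁
      refine ⟨s, t, h.r₂₃ + j, ?_⟩
      have := h.rel₂
      rw [hs] at this
      linarith
    · obtain ⟨t, rfl⟩ := Nat.exists_eq_add_of_le hj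
      obtain ⟨s, hs⟩ := Nat.exists_eq_add_of_lt h.pos₃₁
      refine ⟨s, h.r₃₂ + i, t, ?_⟩
      have := h.rel₃
      rw [hs] at this
      linarith
    · obtain ⟨t, rfl⟩ := Nat.exists_eq_add_of_le hi
      obtain ⟨u, rfl⟩ := Nat.exists_eq_add_of_le hj
      obtain ⟨s, hs⟩ := Nat.exists_eq_add_of_lt (Nat.add_pos_left h.pos₂₁ h.r₃₁)
      refine ⟨s, t, u, ?_⟩
      have := h.rel₁
      rw [hs] at this
      linarith

/-- The first element of the Apéry set with respect to `b₁` that is maximal. -/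
def apery₁ (h : HerzogData b₁ b₂ b₃) : ℕ := (h.r₁₂ + h.r₃₂ - 1) * b₂ + (h.r₁₃ - 1) * b₃

/-- The second element of the Apéry set with respect to `b₁` that is maximal. -/
def apery₂ (h : HerzogData b₁ b₂ b₃) : ℕ := (h.r₁₂ - 1) * b₂ + (h.r₁₃ + h.r₂₃ - 1) * b₃

/-- Equality would give r₃₂b₂ = r₂₃b₃ with 0 < r₃₂ < r₁₂ + r₃₂, against the minimality of the
relation for b₂. -/
lemma apery₁_ne_apery₂ (h : HerzogData b₁ b₂ b₃) : h.apery₁ ≠ h.apery₂ := by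
  intro e
  obtain ⟨s, hs⟩ := Nat.exists_eq_add_of_lt h.pos₁₂
  obtain ⟨t, ht⟩ := Nat.exists_eq_add_of_lt h.pos₁₃
  have e' : h.r₃₂ * b₂ = 0 * b₁ + h.r₂₃ * b₃ := by
    rw [apery₁, apery₂, show h.r₁₂ + h.r₃₂ - 1 = s + h.r₃₂ by omega, show h.r₁₃ - 1 = t by omega,
      show h.r₁₂ - 1 = s by omega, show h.r₁₃ + h.r₂₃ - 1 = t + h.r₂₃ by omega] at e
    linarith
  have := h.min₂ _ _ _ h.pos₃₂ e'
  have := h.pos₁₂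
  omega

/-- The maximal elements of the Apéry set with respect to `b₁`. -/
theorem maximal_apery_iff (h : HerzogData b₁ b₂ b₃) (h₁ : 0 < b₁) (h₂ : 0 < b₂) (h₃ : 0 < b₃)
    (T : Set ℕ) (hT : ∀ n, n ∈ T ↔ ∃ x y z, n = x * b₁ + y * b₂ + z * b₃) (v : ℕ) :
    (v ∈ T ∧ (¬ ∃ t ∈ T, v = b₁ + t) ∧ (∃ t ∈ T, v + b₂ = b₁ + t) ∧ (∃ t ∈ T, v + b₃ = b₁ + t)) ↔
      v = h.apery₁ ∨ v = h.apery₂ := by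
  have key : ∀ n i j, n = i * b₂ + j * b₃ → ((∃ t ∈ T, n = b₁ + t) ↔
      h.r₁₂ + h.r₃₂ ≤ i ∨ h.r₁₃ + h.r₂₃ ≤ j ∨ (h.r₁₂ ≤ i ∧ h.r₁₃ ≤ j)) := by
    rintro n i j rfl
    rw [← h.exists_add_iff h₁ h₂ h₃]
    constructor
    · rintro ⟨t, ht, e⟩
      obtain ⟨x, y, z, rfl⟩ := (hT t).1 ht
      exact ⟨x, y, z, e⟩
    · rintro ⟨x, y, z, e⟩
      exact ⟨_, (hT _).2 ⟨x, y, z, rfl⟩, e⟩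
  have p₁ := h.pos₁₂
  have p₂ := h.pos₁₃
  have p₃ := h.pos₃₂
  have p₄ := h.pos₂₃
  -- The exponents (i, j) allowing no subtraction of b₁ form an L-shaped region; the points from
  -- which both unit steps leave it are its two outer corners.
  have aux : ∀ i j, v = i * b₂ + j * b₃ →
      (((¬ ∃ t ∈ T, v = b₁ + t) ∧ (∃ t ∈ T, v + b₂ = b₁ + t) ∧ (∃ t ∈ T, v + b₃ = b₁ + t)) ↔
      (i = h.r₁₂ + h.r₃₂ - 1 ∧ j = h.r₁₃ - 1) ∨ (i = h.r₁₂ - 1 ∧ j = h.r₁₃ + h.r₂₃ - 1)) := by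
    intro i j hv
    rw [key v i j hv, key (v + b₂) (i + 1) j (by rw [hv]; ring),
      key (v + b₃) i (j + 1) (by rw [hv]; ring)]
    omega
  constructor
  · rintro ⟨hv, hn, hh⟩
    obtain ⟨x, i, j, e⟩ := (hT v).1 hv
    obtain rfl : x = 0 := by
      by_contra hx
      obtain ⟨x, rfl⟩ := Nat.exists_eq_succ_of_ne_zero hx
      exact hn ⟨_, (hT _).2 ⟨x, i, j, rfl⟩, by rw [e, Nat.succ_eq_add_one]; ring⟩
    rw [zero_mul, zero_add] at e
    rcases (aux i j e).1 ⟨hn, hh⟩ with ⟨rfl, rfl⟩ | ⟨rfl, rfl⟩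
    · exact Or.inl e
    · exact Or.inr e
  · rintro (e | e)
    · exact ⟨(hT v).2 ⟨0, _, _, by rw [e, apery₁, zero_mul, zero_add]⟩,
        (aux _ _ e).2 (Or.inl ⟨rfl, rfl⟩)⟩
    · exact ⟨(hT v).2 ⟨0, _, _, by rw [e, apery₂, zero_mul, zero_add]⟩,
        (aux _ _ e).2 (Or.inr ⟨rfl, rfl⟩)⟩

end HerzogData

/-! ### Gluing in ℕ and its effect on Apéry sets -/

/-- Two representations of a number by coprime coefficients differ by a multiple of the trivial
relation. -/
lemma gluing_cases {k₁ k₂ x y x' y' : ℕ} (hk : Nat.Coprime k₁ k₂) (h₂ : 0 < k₂)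
    (h : k₁ * x + k₂ * y = k₁ * x' + k₂ * y') :
    ∃ m, (x = x' + k₂ * m ∧ y' = y + k₁ * m) ∨ (x' = x + k₂ * m ∧ y = y' + k₁ * m) := by
  rcases le_total x' x with hx | hx
  · obtain ⟨d, rfl⟩ := Nat.exists_eq_add_of_le hx
    have e : k₁ * d + k₂ * y = k₂ * y' := by linarith
    have : k₂ ∣ k₁ * d := (Nat.dvd_add_left ⟨y, rfl⟩).1 ⟨y', e⟩
    obtain ⟨m, rfl⟩ := hk.symm.dvd_of_dvd_mul_left this
    exact ⟨m, Or.inl ⟨rfl, Nat.eq_of_mul_eq_mul_left h₂ (by linarith)⟩⟩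
  · obtain ⟨d, rfl⟩ := Nat.exists_eq_add_of_le hx
    have e : k₁ * d + k₂ * y' = k₂ * y := by linarith
    have : k₂ ∣ k₁ * d := (Nat.dvd_add_left ⟨y', rfl⟩).1 ⟨y, e⟩
    obtain ⟨m, rfl⟩ := hk.symm.dvd_of_dvd_mul_left this
    exact ⟨m, Or.inr ⟨rfl, Nat.eq_of_mul_eq_mul_left h₂ (by linarith)⟩⟩

/-- The maximal elements of the Apéry set of `k₁ℕ + k₂T` with respect to `k₂b` come from those of
the Apéry set of `T` with respect to `b`. -/
theorem maximal_apery_gluing_iff {k₁ k₂ b : ℕ} (hk : Nat.Coprime k₁ k₂) (h₂ : 0 < k₂)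
    (T : AddSubmonoid ℕ) (hkT : k₁ ∈ T) (S : Set ℕ)
    (hS : ∀ n, n ∈ S ↔ ∃ m, ∃ t ∈ T, n = k₁ * m + k₂ * t) (G : Set ℕ) (hG : ∀ g ∈ G, g ∈ T)
    (hkG : ∀ v ∈ T, (∀ g ∈ G, ∃ t ∈ T, v + g = b + t) → ∃ t ∈ T, v + k₁ = b + t) (w : ℕ) :
    (w ∈ S ∧ (¬ ∃ s ∈ S, w = k₂ * b + s) ∧ (∃ s ∈ S, w + k₁ = k₂ * b + s) ∧
        ∀ g ∈ G, ∃ s ∈ S, w + k₂ * g = k₂ * b + s) ↔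
      ∃ v, (v ∈ T ∧ (¬ ∃ t ∈ T, v = b + t) ∧ ∀ g ∈ G, ∃ t ∈ T, v + g = b + t) ∧
        w = k₂ * v + (k₂ - 1) * k₁ := by
  -- Here l = k₂ − 1 is the largest number of copies of k₁ in a reduced expression, because k₂
  -- copies of k₁ are absorbed into k₂T.
  obtain ⟨l, rfl⟩ := Nat.exists_eq_add_of_lt h₂
  simp only [zero_add] at *
  rw [Nat.add_sub_cancel]
  -- divisibility by `b` in `T` can be read off in `S`
  have key : ∀ v ∈ T, (∃ s ∈ S, (l + 1) * v + l * k₁ = (l + 1) * b + s) ↔ ∃ t ∈ T, v = b + t := by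
    intro v hv
    constructor
    · rintro ⟨s, hs, e⟩
      obtain ⟨m, t, ht, rfl⟩ := (hS s).1 hs
      obtain ⟨j, hj⟩ := gluing_cases (x := l) (y := v) (x' := m) (y' := b + t) hk h₂ (by linarith)
      rcases hj with ⟨hj, hj'⟩ | ⟨hj, hj'⟩
      · obtain rfl : j = 0 := by
          by_contra h
          have := Nat.mul_le_mul_left (l + 1) (Nat.one_le_iff_ne_zero.2 h)
          omega
        exact ⟨t, ht, by omega⟩
      · refine ⟨t + k₁ * j, T.add_mem ht ?_, by omega⟩
        rw [mul_comm, ← smul_eq_mul]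
        exact T.nsmul_mem hkT j
    · rintro ⟨t, ht, rfl⟩
      exact ⟨k₁ * l + (l + 1) * t, (hS _).2 ⟨l, t, ht, rfl⟩, by ring⟩
  constructor
  · rintro ⟨hw, hn, hk₁, hg⟩
    obtain ⟨m, t, ht, rfl⟩ := (hS w).1 hw
    have hkm : ∀ n, k₁ * n ∈ T := fun n => by
      rw [mul_comm, ← smul_eq_mul]; exact T.nsmul_mem hkT n
    -- reduce the multiple of `k₁`
    obtain ⟨m, t, ht, hm, e⟩ : ∃ m', ∃ t' ∈ T, m' ≤ l ∧
        k₁ * m + (l + 1) * t = k₁ * m' + (l + 1) * t' := by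
      refine ⟨m % (l + 1), t + k₁ * (m / (l + 1)), T.add_mem ht (hkm _),
        Nat.lt_succ_iff.1 (Nat.mod_lt _ h₂), ?_⟩
      conv_lhs => rw [← Nat.mod_add_div m (l + 1)]
      ring
    rw [e] at hw hn hk₁ hg ⊢
    obtain ⟨s, hs, es⟩ := hk₁
    obtain ⟨m', t', ht', rfl⟩ := (hS s).1 hs
    -- If m < l, adding one k₁ causes no carry modulo k₂, so k₂b could already be subtracted from w
    -- itself.
    obtain rfl : m = l := by
      by_contra hml
      obtain ⟨j, hj⟩ := gluing_cases (x := m + 1) (y := t) (x' := m') (y' := b + t') hk h₂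
        (by linarith)
      rcases hj with ⟨hj, hj'⟩ | ⟨hj, hj'⟩
      · obtain rfl : j = 0 := by
          by_contra h
          have := Nat.mul_le_mul_left (l + 1) (Nat.one_le_iff_ne_zero.2 h)
          omega
        exact hn ⟨k₁ * m + (l + 1) * t', (hS _).2 ⟨m, t', ht', rfl⟩, by
          rw [show t = b + t' by omega]; ring⟩
      · exact hn ⟨k₁ * m + (l + 1) * (t' + k₁ * j),
          (hS _).2 ⟨m, _, T.add_mem ht' (hkm j), rfl⟩, by rw [hj']; ring⟩
    refine ⟨t, ⟨ht, fun h => hn ?_, fun g hgG => ?_⟩, by ring⟩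
    · obtain ⟨s, hs, e⟩ := (key t ht).2 h
      exact ⟨s, hs, by linarith⟩
    · obtain ⟨s, hs, e⟩ := hg g hgG
      exact (key _ (T.add_mem ht (hG g hgG))).1 ⟨s, hs, by linarith⟩
  · rintro ⟨v, ⟨hv, hn, hg⟩, rfl⟩
    refine ⟨(hS _).2 ⟨l, v, hv, by ring⟩, fun h => hn ((key v hv).1 h), ?_, fun g hgG => ?_⟩
    · obtain ⟨t, ht, e⟩ := hkG v hv hg
      exact ⟨k₁ * 0 + (l + 1) * t, (hS _).2 ⟨0, t, ht, rfl⟩, by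
        calc _ = (l + 1) * (v + k₁) := by ring
          _ = _ := by rw [e]; ring⟩
    · obtain ⟨s, hs, e⟩ := (key _ (T.add_mem hv (hG g hgG))).2 (hg g hgG)
      exact ⟨s, hs, by rw [← e]; ring⟩

/-! ### Toric ideals of weights in a commutative monoid -/

section Toric

variable {k σ ι M : Type*} [Field k] [Fintype ι] [AddCommMonoid M]

/-- The monomial with exponents `v`, for variables indexed by `ι` along `e`. -/
noncomputable def mono (k : Type*) [Field k] {σ : Type*} (e : ι ≃ σ) (v : ι → ℕ) :
    MvPolynomial σ k :=
  MvPolynomial.monomial (Finsupp.equivFunOnFinite.symm v |>.mapDomain e) 1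

/-- The weight of an exponent vector. -/
def weight (ω : ι → M) (v : ι → ℕ) : M := ∑ i, v i • ω i

lemma mono_add (e : ι ≃ σ) (u v : ι → ℕ) : mono k e (u + v) = mono k e u * mono k e v := by
  rw [mono, mono, mono, MvPolynomial.monomial_mul, one_mul, ← Finsupp.mapDomain_add]
  congr
  ext; simp

lemma mono_zero (e : ι ≃ σ) : mono k e 0 = 1 := by
  rw [mono, show Finsupp.equivFunOnFinite.symm (0 : ι → ℕ) = 0 by ext; simp,
    Finsupp.mapDomain_zero]
  rfl

lemma mono_single [DecidableEq ι] (e : ι ≃ σ) (i : ι) (n : ℕ) :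
    mono k e (Pi.single i n) = MvPolynomial.X (e i) ^ n := by
  rw [mono, MvPolynomial.X_pow_eq_monomial]
  congr 1
  rw [show Finsupp.equivFunOnFinite.symm (Pi.single i n) = Finsupp.single i n by
    ext j; simp [Finsupp.single_apply], Finsupp.mapDomain_single]

lemma mono_eq_prod (e : ι ≃ σ) (v : ι → ℕ) :
    mono k e v = ∏ i, MvPolynomial.X (e i) ^ v i := by
  classical
  have : ∀ s : Finset ι, mono k e (∑ i ∈ s, Pi.single i (v i)) =
      ∏ i ∈ s, MvPolynomial.X (e i) ^ v i := by
    intro s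
    induction s using Finset.induction_on with
    | empty => simp [mono_zero]
    | insert i s hi ih => rw [Finset.sum_insert hi, Finset.prod_insert hi, mono_add, mono_single, ih]
  rw [← this, Finset.univ_sum_single]

lemma mono_injective (e : ι ≃ σ) : Function.Injective (mono k e) := by
  intro u v h
  have := MvPolynomial.monomial_left_injective one_ne_zero h
  exact Finsupp.equivFunOnFinite.symm.injective (Finsupp.mapDomain_injective e.injective this)

lemma exists_monomial_eq_mono (e : ι ≃ σ) (s : σ →₀ ℕ) :
    ∃ v, MvPolynomial.monomial s (1 : k) = mono k e v := by
  refine ⟨fun i => s (e i), ?_⟩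
  have : s = (Finsupp.equivFunOnFinite.symm fun i => s (e i)).mapDomain e := by
    ext j
    obtain ⟨i, rfl⟩ := e.surjective j
    rw [Finsupp.mapDomain_apply e.injective]
    rfl
  rw [mono, ← this]

/-- The map of monoid algebras sending each variable to the monomial of its weight. -/
noncomputable def toricMap (k : Type*) [Field k] {σ : Type*} (e : ι ≃ σ) (ω : ι → M) :
    MvPolynomial σ k →ₐ[k] AddMonoidAlgebra k M :=
  MvPolynomial.aeval fun s => AddMonoidAlgebra.single (ω (e.symm s)) 1

lemma toricMap_mono (e : ι ≃ σ) (ω : ι → M) (v : ι → ℕ) :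
    toricMap k e ω (mono k e v) = AddMonoidAlgebra.single (weight ω v) 1 := by
  classical
  have : ∀ s : Finset ι, ∏ i ∈ s, (AddMonoidAlgebra.single (ω i) (1 : k)) ^ v i =
      AddMonoidAlgebra.single (∑ i ∈ s, v i • ω i) 1 := by
    intro s
    induction s using Finset.induction_on with
    | empty => simp [AddMonoidAlgebra.one_def]
    | insert i s hi ih =>
      rw [Finset.prod_insert hi, Finset.sum_insert hi, ih, AddMonoidAlgebra.single_pow,
        AddMonoidAlgebra.single_mul_single]
      simp
  rw [mono_eq_prod, map_prod, weight, ← this]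
  simp [toricMap]

/-- The toric ideal of a weight. -/
noncomputable def toricIdeal (k : Type*) [Field k] {σ : Type*} (e : ι ≃ σ) (ω : ι → M) :
    Ideal (MvPolynomial σ k) :=
  RingHom.ker (toricMap k e ω)

lemma mono_sub_mono_mem_toricIdeal (e : ι ≃ σ) (ω : ι → M) (u v : ι → ℕ) :
    mono k e u - mono k e v ∈ toricIdeal k e ω ↔ weight ω u = weight ω v := by
  rw [toricIdeal, RingHom.mem_ker, map_sub, toricMap_mono, toricMap_mono, sub_eq_zero]
  exact ⟨fun h => AddMonoidAlgebra.single_left_injective one_ne_zero h, fun h => by rw [h]⟩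

/-- Unique sums make the monoid algebra a domain, so the kernel is prime. All regularity statements
below rest on this. -/
instance [UniqueSums M] (e : ι ≃ σ) (ω : ι → M) : (toricIdeal k e ω).IsPrime :=
  have : NoZeroDivisors (AddMonoidAlgebra k M) := inferInstance
  have : IsDomain (AddMonoidAlgebra k M) := NoZeroDivisors.to_isDomain _
  RingHom.ker_isPrime _

/-- An ideal containing enough binomials contains the toric ideal. -/
theorem toricIdeal_le (e : ι ≃ σ) (ω : ι → M) (J : Ideal (MvPolynomial σ k))
    (hJ : ∀ u v, weight ω u = weight ω v → mono k e u - mono k e v ∈ J) :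
    toricIdeal k e ω ≤ J := by
  classical
  intro F hF
  -- One monomial is chosen for each weight attained. Extended linearly to `L`, this choice
  -- satisfies F ≡ L(toricMap F) modulo J, so every F in the kernel lies in J.
  let sec : M → MvPolynomial σ k := fun m =>
    if h : ∃ v, weight ω v = m then mono k e h.choose else 0
  have hsec : ∀ v, mono k e v - sec (weight ω v) ∈ J := by
    intro v
    have h : ∃ v', weight ω v' = weight ω v := ⟨v, rfl⟩
    simp only [sec, dif_pos h]
    exact hJ _ _ h.choose_spec.symm
  let L : AddMonoidAlgebra k M →ₗ[k] MvPolynomial σ k :=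
    Finsupp.linearCombination k sec ∘ₗ (AddMonoidAlgebra.coeffLinearEquiv k).toLinearMap
  have key : ∀ F : MvPolynomial σ k, F - L (toricMap k e ω F) ∈ J := by
    intro F
    induction F using MvPolynomial.induction_on' with
    | monomial s a =>
      obtain ⟨v, hv⟩ := exists_monomial_eq_mono (k := k) e s
      have : MvPolynomial.monomial s a = a • mono k e v := by
        rw [← hv, MvPolynomial.smul_monomial, smul_eq_mul, mul_one]
      rw [this, map_smul, map_smul, toricMap_mono, ← smul_sub]
      have h2 : L (AddMonoidAlgebra.single (weight ω v) 1) = sec (weight ω v) := by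
        simp [L]
      rw [h2, MvPolynomial.smul_eq_C_mul]
      exact J.mul_mem_left _ (hsec v)
    | add p q hp hq =>
      rw [map_add, map_add, add_sub_add_comm]
      exact J.add_mem hp hq
  have := key F
  rwa [(RingHom.mem_ker).1 hF, map_zero, sub_zero] at this

/-- The congruence on exponents defined by an ideal. -/
def idealCon (e : ι ≃ σ) (J : Ideal (MvPolynomial σ k)) : AddCon (ι → ℕ) where
  r u v := mono k e u - mono k e v ∈ J
  iseqv :=
    { refl := fun u => by simp
      symm := fun {u v} h => by rw [← neg_sub]; exact J.neg_mem h
      trans := fun {u v w} h h' => by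
        rw [← sub_add_sub_cancel]; exact J.add_mem h h' }
  add' := fun {u v u' v'} h h' => by
    rw [mono_add, mono_add,
      show mono k e u * mono k e u' - mono k e v * mono k e v' =
        mono k e u' * (mono k e u - mono k e v) + mono k e v * (mono k e u' - mono k e v') by ring]
    exact J.add_mem (J.mul_mem_left _ h) (J.mul_mem_left _ h')

/-- Adding a binomial to a toric ideal gives the toric ideal of a glued weight. -/
theorem toricIdeal_gluing {N : Type*} [AddCommMonoid N] (e : ι ≃ σ) (ω : ι → M) (ω' : ι → N)
    (α β : ι → ℕ) (h₁ : ∀ u v, weight ω u = weight ω v → weight ω' u = weight ω' v)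
    (hαβ : weight ω' α = weight ω' β)
    (h₂ : ∀ u v, weight ω' u = weight ω' v → ∃ (p : ι → ℕ) (m : ℕ),
      (weight ω u = weight ω (p + m • α) ∧ weight ω v = weight ω (p + m • β)) ∨
      (weight ω v = weight ω (p + m • α) ∧ weight ω u = weight ω (p + m • β))) :
    toricIdeal k e ω' = toricIdeal k e ω ⊔ Ideal.span {mono k e α - mono k e β} := by
  set J := toricIdeal k e ω ⊔ Ideal.span {mono k e α - mono k e β} with hJ
  apply le_antisymm
  · apply toricIdeal_le
    intro u v huv
    -- The new binomial allows m copies of α to be exchanged for m copies of β; all other moves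
    -- preserve the old weight.
    have hr : ∀ (p : ι → ℕ) (m : ℕ), idealCon e J (p + m • α) (p + m • β) := by
      intro p m
      have : idealCon e J α β :=
        (le_sup_right : _ ≤ J) (Ideal.subset_span rfl)
      exact (idealCon e J).add ((idealCon e J).refl p) ((idealCon e J).nsmul m this)
    have ht : ∀ u v, weight ω u = weight ω v → idealCon e J u v := fun u v h =>
      (le_sup_left : _ ≤ J) ((mono_sub_mono_mem_toricIdeal e ω u v).2 h)
    change idealCon e J u v
    obtain ⟨p, m, ⟨hu, hv⟩ | ⟨hv, hu⟩⟩ := h₂ u v huv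
    · exact (idealCon e J).trans (ht _ _ hu)
        ((idealCon e J).trans (hr p m) ((idealCon e J).symm (ht _ _ hv)))
    · exact (idealCon e J).trans (ht _ _ hu)
        ((idealCon e J).trans ((idealCon e J).symm (hr p m)) ((idealCon e J).symm (ht _ _ hv)))
  · apply sup_le
    · apply toricIdeal_le
      intro u v h
      exact (mono_sub_mono_mem_toricIdeal e ω' u v).2 (h₁ u v h)
    · rw [Ideal.span_singleton_le_iff_mem]
      exact (mono_sub_mono_mem_toricIdeal e ω' α β).2 hαβ

/-- The toric ideal of a weight that separates exponents is zero. -/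
lemma toricIdeal_eq_bot (e : ι ≃ σ) (ω : ι → M) (h : Function.Injective (weight ω)) :
    toricIdeal k e ω = ⊥ :=
  le_bot_iff.1 <| toricIdeal_le e ω ⊥ fun u v huv => by rw [h huv, sub_self]; exact Ideal.zero_mem _

end Toric

/-! ### The defining ideal as a toric ideal, and complete intersections -/

section

universe u

variable {k : Type u} [Field k] {C : Finset ℕ} {ι : Type*}

/-- k[t] is the monoid algebra of ℕ, so the two kernels coincide. The equivalence `e` leaves the
numbering of the generators free. -/
lemma definingIdeal_eq_toricIdeal (e : ι ≃ C) :
    definingIdeal k C = toricIdeal k e fun i => (e i : ℕ) := by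
  have : (Polynomial.toFinsuppIsoAlg k : Polynomial k →ₐ[k] AddMonoidAlgebra k ℕ).comp
      (monomialMap k C) = toricMap k e fun i => (e i : ℕ) := by
    ext1 c
    simp [monomialMap, toricMap, Polynomial.toFinsuppIsoAlg, Polynomial.toFinsuppIso]
  ext F
  rw [definingIdeal, toricIdeal, RingHom.mem_ker, RingHom.mem_ker, ← this, AlgHom.comp_apply]
  exact (EmbeddingLike.map_eq_zero_iff (f := Polynomial.toFinsuppIsoAlg k)).symm

end

/-- A sequence of three elements, each of which avoids the prime ideal generated by the previous
ones, is regular. -/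
lemma isRegular_of_primes {R : Type*} [CommRing R] {f₁ f₂ f₃ : R}
    [IsDomain R] (h₁ : f₁ ≠ 0) [(Ideal.span {f₁}).IsPrime] (h₂ : f₂ ∉ Ideal.span {f₁})
    [(Ideal.span {f₁} ⊔ Ideal.span {f₂}).IsPrime] (h₃ : f₃ ∉ Ideal.span {f₁} ⊔ Ideal.span {f₂})
    (h : Ideal.ofList [f₁, f₂, f₃] ≠ ⊤) : RingTheory.Sequence.IsRegular R [f₁, f₂, f₃] := by
  have key : ∀ (P : Ideal R), P.IsPrime → ∀ f, f ∉ P →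
      IsSMulRegular (R ⧸ (P • ⊤ : Submodule R R)) f := by
    intro P hP f hf
    rw [isSMulRegular_quotient_iff_mem_of_smul_mem]
    intro x hx
    simp only [smul_eq_mul, Ideal.mul_top] at hx ⊢
    exact (hP.mem_or_mem hx).resolve_left hf
  constructor
  · constructor
    intro i hi
    simp only [List.length_cons, List.length_nil] at hi
    have : i = 0 ∨ i = 1 ∨ i = 2 := by omega
    rcases this with rfl | rfl | rfl
    · exact key _ (by simpa using Ideal.isPrime_bot) _ (by simpa using h₁)
    · exact key _ (by simpa) _ (by simpa using h₂)
    · refine key _ ?_ _ ?_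
      · simpa [Ideal.ofList_cons]
      · simpa [Ideal.ofList_cons] using h₃
  · simpa using h.symm

section CompleteIntersection

universe u

variable {k : Type u} [Field k] {C : Finset ℕ}

lemma definingIdeal_isPrime : (definingIdeal k C).IsPrime :=
  RingHom.ker_isPrime _

/-- A chain of toric ideals, each generated over the previous one by a binomial, gives a complete
intersection. -/
theorem isCompleteIntersection_of_toric {M N ι : Type*} [Fintype ι] [AddCommMonoid M]
    [UniqueSums M] [AddCommMonoid N] [UniqueSums N] (e : ι ≃ C) (ω₁ : ι → M) (ω₂ : ι → N)
    (α₁ β₁ α₂ β₂ α₃ β₃ : ι → ℕ)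
    (h₁ : toricIdeal k e ω₁ = Ideal.span {mono k e α₁ - mono k e β₁})
    (h₂ : toricIdeal k e ω₂ = toricIdeal k e ω₁ ⊔ Ideal.span {mono k e α₂ - mono k e β₂})
    (h₃ : definingIdeal k C = toricIdeal k e ω₂ ⊔ Ideal.span {mono k e α₃ - mono k e β₃})
    (n₁ : α₁ ≠ β₁) (n₂ : weight ω₁ α₂ ≠ weight ω₁ β₂) (n₃ : weight ω₂ α₃ ≠ weight ω₂ β₃) :
    IsCompleteIntersection k C := by
  have hI : Ideal.ofList [mono k e α₁ - mono k e β₁, mono k e α₂ - mono k e β₂,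
      mono k e α₃ - mono k e β₃] = definingIdeal k C := by
    rw [h₃, h₂, h₁]
    simp [Ideal.ofList_cons, sup_assoc]
  have p₁ : (Ideal.span {mono k e α₁ - mono k e β₁}).IsPrime := by
    rw [← h₁]; infer_instance
  have p₂ : (Ideal.span {mono k e α₁ - mono k e β₁} ⊔
      Ideal.span {mono k e α₂ - mono k e β₂}).IsPrime := by
    rw [← h₁, ← h₂]; infer_instance
  refine ⟨_, isRegular_of_primes ?_ ?_ ?_ ?_, hI⟩
  · rw [sub_ne_zero]
    exact (mono_injective _).ne n₁
  · rwa [← h₁, mono_sub_mono_mem_toricIdeal]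
  · rwa [← h₁, ← h₂, mono_sub_mono_mem_toricIdeal]
  · rw [hI]
    exact definingIdeal_isPrime.ne_top

/-- The toric ideal for two blocks of two variables, with the other variables kept apart. -/
lemma toricIdeal_two_block {σ : Type*} (e : Fin 4 ≃ σ) {a₁ a₂ : ℕ} (ha : Nat.Coprime a₁ a₂)
    (h₂ : 0 < a₂) :
    toricIdeal k e (![(1, 0, 0), (0, a₁, 0), (0, a₂, 0), (0, 0, 1)] : Fin 4 → ℕ × ℕ × ℕ) =
      Ideal.span {mono k e ![0, a₂, 0, 0] - mono k e ![0, 0, a₁, 0]} := by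
  -- The starting point is the free weight in ℕ⁴, whose toric ideal is zero; identifying a₂ copies
  -- of the second basis weight with a₁ copies of the third adds the only generator.
  rw [toricIdeal_gluing e (![(1, 0, 0, 0), (0, 1, 0, 0), (0, 0, 1, 0), (0, 0, 0, 1)] :
    Fin 4 → ℕ × ℕ × ℕ × ℕ) _ ![0, a₂, 0, 0] ![0, 0, a₁, 0], toricIdeal_eq_bot, bot_sup_eq]
  · intro u v h
    simp only [weight, Fin.sum_univ_four] at h
    simp at h
    ext i; fin_cases i <;> simp [h]
  · intro u v h
    simp only [weight, Fin.sum_univ_four] at h ⊢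
    simp at h ⊢
    simp [h]
  · simp only [weight, Fin.sum_univ_four]
    simp [mul_comm]
  · intro u v h
    simp only [weight, Fin.sum_univ_four] at h ⊢
    simp at h ⊢
    obtain ⟨h0, h1, h3⟩ := h
    obtain ⟨m, h | h⟩ := gluing_cases (x := u 1) (y := u 2) (x' := v 1) (y' := v 2) ha h₂
      (by linarith)
    · exact ⟨![v 0, v 1, u 2, u 3], m, Or.inl (by simp [h, h0, h3, mul_comm])⟩
    · exact ⟨![v 0, u 1, v 2, u 3], m, Or.inr (by simp [h, h0, h3, mul_comm])⟩

/-- Gluing a variable to three variables. -/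
lemma definingIdeal_eq_sup (e : Fin 4 ≃ C) {k₁ k₂ b₁ b₂ b₃ x y z : ℕ} (hk : Nat.Coprime k₁ k₂)
    (hk₂ : 0 < k₂) (e0 : (e 0 : ℕ) = k₁) (e1 : (e 1 : ℕ) = k₂ * b₁) (e2 : (e 2 : ℕ) = k₂ * b₂)
    (e3 : (e 3 : ℕ) = k₂ * b₃) (hx : k₁ = x * b₁ + y * b₂ + z * b₃) :
    definingIdeal k C = toricIdeal k e (![(1, 0), (0, b₁), (0, b₂), (0, b₃)] : Fin 4 → ℕ × ℕ) ⊔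
      Ideal.span {mono k e ![k₂, 0, 0, 0] - mono k e ![0, x, y, z]} := by
  rw [definingIdeal_eq_toricIdeal e]
  apply toricIdeal_gluing
  · intro u v h
    simp only [weight, Fin.sum_univ_four, e0, e1, e2, e3] at h ⊢
    simp at h ⊢
    rw [h.1]
    linear_combination k₂ * h.2
  · simp only [weight, Fin.sum_univ_four, e0, e1, e2, e3]
    simp [hx]
    ring
  · intro u v h
    simp only [weight, Fin.sum_univ_four, e0, e1, e2, e3] at h ⊢
    simp at h ⊢
    obtain ⟨m, h | h⟩ := gluing_cases (x := u 0) (y := u 1 * b₁ + u 2 * b₂ + u 3 * b₃) (x' := v 0)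
      (y' := v 1 * b₁ + v 2 * b₂ + v 3 * b₃) hk hk₂ (by linarith)
    · refine ⟨![v 0, u 1, u 2, u 3], m, Or.inl ?_⟩
      simp [h, mul_comm m]
      rw [hx]; ring
    · refine ⟨![u 0, v 1, v 2, v 3], m, Or.inr ?_⟩
      simp [h, mul_comm m]
      rw [hx]; ring

/-- With d = gcd(b₁, b₂), bᵢ = aᵢd for i = 1, 2, the gluing hypothesis becomes b₃ = p a₁ + q a₂. The
three identifications relate x₁ to x₂, then x₃ᵈ to x₁ᵖx₂^q, then x₀^k₂ to a monomial of weight k₁k₂.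
-/
theorem isCompleteIntersection_of_gluing_one_three (e : Fin 4 ≃ C) {k₁ k₂ b₁ b₂ b₃ : ℕ}
    (hk : Nat.Coprime k₁ k₂) (hk₂ : 0 < k₂) (e0 : (e 0 : ℕ) = k₁) (e1 : (e 1 : ℕ) = k₂ * b₁)
    (e2 : (e 2 : ℕ) = k₂ * b₂) (e3 : (e 3 : ℕ) = k₂ * b₃) (h₁ : 0 < b₁) (h₂ : 0 < b₂) (h₃ : 0 < b₃)
    (hb : Nat.gcd (Nat.gcd b₁ b₂) b₃ = 1) (hx : ∃ x y z, k₁ = x * b₁ + y * b₂ + z * b₃)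
    (hg : ∃ p q, Nat.gcd b₁ b₂ * b₃ = p * b₁ + q * b₂) : IsCompleteIntersection k C := by
  obtain ⟨x, y, z, hx⟩ := hx
  obtain ⟨p, q, hg⟩ := hg
  obtain ⟨d, a₁, a₂, hd, ha, rfl, rfl⟩ := Nat.exists_coprime' (Nat.gcd_pos_of_pos_left b₂ h₁)
  have ha₁ : 0 < a₁ := Nat.pos_of_mul_pos_right h₁
  have ha₂ : 0 < a₂ := Nat.pos_of_mul_pos_right h₂
  have hgcd : Nat.gcd (a₁ * d) (a₂ * d) = d := by
    rw [Nat.gcd_mul_right, ha, one_mul]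
  rw [hgcd] at hb hg
  have hb₃ : b₃ = p * a₁ + q * a₂ := Nat.eq_of_mul_eq_mul_left hd (by linarith)
  refine isCompleteIntersection_of_toric e _ _ ![0, a₂, 0, 0] ![0, 0, a₁, 0] ![0, p, q, 0]
    ![0, 0, 0, d] ![k₂, 0, 0, 0] ![0, x, y, z] (toricIdeal_two_block e ha ha₂) ?_
    (definingIdeal_eq_sup e hk hk₂ e0 e1 e2 e3 hx) ?_ ?_ ?_
  · apply toricIdeal_gluing
    · intro u v h
      simp only [weight, Fin.sum_univ_four] at h ⊢
      simp at h ⊢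
      simp only [h, true_and]
      linear_combination d * h.2.1
    · simp only [weight, Fin.sum_univ_four]
      simp [hg]
    · intro u v h
      simp only [weight, Fin.sum_univ_four] at h ⊢
      simp at h ⊢
      obtain ⟨m, h' | h'⟩ := gluing_cases (x := u 1 * a₁ + u 2 * a₂) (y := u 3)
        (x' := v 1 * a₁ + v 2 * a₂) (y' := v 3) hb h₃ (by linarith)
      · refine ⟨![v 0, v 1, v 2, u 3], m, Or.inl ?_⟩
        simp [h, h', mul_comm d m]
        rw [hb₃]; ring
      · refine ⟨![v 0, u 1, u 2, v 3], m, Or.inr ?_⟩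
        simp [h, h', mul_comm d m]
        rw [hb₃]; ring
  · intro h
    simpa [ha₂.ne'] using congrFun h 1
  · simp only [weight, Fin.sum_univ_four]
    simp [hd.ne]
  · simp only [weight, Fin.sum_univ_four]
    simp [hk₂.ne']

/-- Each coprime pair contributes its single relation, and the last binomial equates expressions of
weight k₁k₂ from the two blocks. The pair from A occupies the middle positions to match
`toricIdeal_two_block`. -/
theorem isCompleteIntersection_of_gluing_two_two (e : Fin 4 ≃ C) {k₁ k₂ a₁ a₂ b₁ b₂ : ℕ}
    (hk : Nat.Coprime k₁ k₂) (hk₂ : 0 < k₂) (ha : Nat.Coprime a₁ a₂) (hb : Nat.Coprime b₁ b₂)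
    (ha₂ : 0 < a₂) (hb₂ : 0 < b₂) (e0 : (e 0 : ℕ) = k₂ * b₁) (e1 : (e 1 : ℕ) = k₁ * a₁)
    (e2 : (e 2 : ℕ) = k₁ * a₂) (e3 : (e 3 : ℕ) = k₂ * b₂) (hx : ∃ x y, k₁ = x * b₁ + y * b₂)
    (hy : ∃ x y, k₂ = x * a₁ + y * a₂) : IsCompleteIntersection k C := by
  obtain ⟨x, y, hx⟩ := hx
  obtain ⟨p, q, hy⟩ := hy
  refine isCompleteIntersection_of_toric e _
    (![(b₁, 0), (0, a₁), (0, a₂), (b₂, 0)] : Fin 4 → ℕ × ℕ) ![0, a₂, 0, 0] ![0, 0, a₁, 0]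
    ![b₂, 0, 0, 0] ![0, 0, 0, b₁] ![0, p, q, 0] ![x, 0, 0, y] (toricIdeal_two_block e ha ha₂) ?_
    ?_ ?_ ?_ ?_
  · apply toricIdeal_gluing
    · intro u v h
      simp only [weight, Fin.sum_univ_four] at h ⊢
      simp at h ⊢
      simp [h]
    · simp only [weight, Fin.sum_univ_four]
      simp [mul_comm]
    · intro u v h
      simp only [weight, Fin.sum_univ_four] at h ⊢
      simp at h ⊢
      obtain ⟨m, h' | h'⟩ := gluing_cases (x := u 0) (y := u 3)
        (x' := v 0) (y' := v 3) hb hb₂ (by linarith)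
      · exact ⟨![v 0, u 1, u 2, u 3], m, Or.inl (by simp [h, h', mul_comm m])⟩
      · exact ⟨![u 0, u 1, u 2, v 3], m, Or.inr (by simp [h, h', mul_comm m])⟩
  · rw [definingIdeal_eq_toricIdeal e]
    apply toricIdeal_gluing
    · intro u v h
      simp only [weight, Fin.sum_univ_four, e0, e1, e2, e3] at h ⊢
      simp at h ⊢
      linear_combination k₂ * h.1 + k₁ * h.2
    · simp only [weight, Fin.sum_univ_four, e0, e1, e2, e3]
      simp
      rw [hx, hy]
      ring
    · intro u v h
      simp only [weight, Fin.sum_univ_four, e0, e1, e2, e3] at h ⊢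
      simp at h ⊢
      obtain ⟨m, h' | h'⟩ := gluing_cases (x := u 1 * a₁ + u 2 * a₂) (y := u 0 * b₁ + u 3 * b₂)
        (x' := v 1 * a₁ + v 2 * a₂) (y' := v 0 * b₁ + v 3 * b₂) hk hk₂ (by linarith)
      · refine ⟨![u 0, v 1, v 2, u 3], m, Or.inl ?_⟩
        simp [h']
        rw [hx, hy]
        constructor <;> ring
      · refine ⟨![v 0, u 1, u 2, v 3], m, Or.inr ?_⟩
        simp [h']
        rw [hx, hy]
        constructor <;> ring
  · intro h
    simpa [ha₂.ne'] using congrFun h 1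
  · simp only [weight, Fin.sum_univ_four]
    simp [hb₂.ne']
  · simp only [weight, Fin.sum_univ_four]
    simp [← hx, ← hy]
    omega

end CompleteIntersection

/-! ### Syzygies of the maximal minors of a 2 × 3 matrix -/

section HilbertBurch

variable {R : Type*} [CommRing R]

/-- Proportional triples, in a factorial domain. -/
lemma exists_mul_eq_of_proportional [IsDomain R] [UniqueFactorizationMonoid R]
    {f₁ f₂ f₃ r₁ r₂ r₃ : R} (hf : f₁ ≠ 0)
    (hrel : ∀ d, d ∣ f₁ → d ∣ f₂ → d ∣ f₃ → IsUnit d) (h₂ : r₁ * f₂ = r₂ * f₁)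
    (h₃ : r₁ * f₃ = r₃ * f₁) : ∃ a, r₁ = a * f₁ ∧ r₂ = a * f₂ ∧ r₃ = a * f₃ := by
  classical
  let := UniqueFactorizationMonoid.toGCDMonoid R
  -- f₁ divides both r₁f₂ and r₁f₃, hence r₁ gcd(f₂, f₃), and it is coprime to that gcd.
  have hd : f₁ ∣ r₁ * gcd f₂ f₃ :=
    (dvd_gcd ⟨r₂, by rw [h₂, mul_comm]⟩ ⟨r₃, by rw [h₃, mul_comm]⟩).trans
      (gcd_mul_left' r₁ f₂ f₃).dvd
  have hp : IsRelPrime f₁ (gcd f₂ f₃) := fun d h h' =>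
    hrel d h (h'.trans (gcd_dvd_left _ _)) (h'.trans (gcd_dvd_right _ _))
  obtain ⟨a, rfl⟩ := hp.dvd_of_dvd_mul_right hd
  refine ⟨a, mul_comm _ _, ?_, ?_⟩
  · exact mul_right_cancel₀ hf (by linear_combination -h₂)
  · exact mul_right_cancel₀ hf (by linear_combination -h₃)

/-- The Hilbert–Burch theorem for a `2 × 3` matrix: the syzygies of the maximal minors are generated
by the rows, when the minors have no common factor. -/
theorem exists_combination_of_syzygy [IsDomain R] [UniqueFactorizationMonoid R]
    {p₁ p₂ p₃ q₁ q₂ q₃ f₁ f₂ f₃ g₁ g₂ g₃ : R} (e₁ : f₁ = p₂ * q₃ - p₃ * q₂)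
    (e₂ : f₂ = p₃ * q₁ - p₁ * q₃) (e₃ : f₃ = p₁ * q₂ - p₂ * q₁) (hf : f₁ ≠ 0)
    (hrel : ∀ d, d ∣ f₁ → d ∣ f₂ → d ∣ f₃ → IsUnit d) (h : f₁ * g₁ + f₂ * g₂ + f₃ * g₃ = 0) :
    ∃ a b, g₁ = p₁ * a + q₁ * b ∧ g₂ = p₂ * a + q₂ * b ∧ g₃ = p₃ * a + q₃ * b := by
  -- In cross products, f = p × q and g is orthogonal to f, so g × q and p × g are proportional to
  -- f. Coprimality of the fᵢ makes them a f and b f, and these are the coefficients in g = a p + b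
  -- q.
  obtain ⟨a, a₁, a₂, a₃⟩ := exists_mul_eq_of_proportional (r₁ := g₂ * q₃ - g₃ * q₂)
    (r₂ := g₃ * q₁ - g₁ * q₃) (r₃ := g₁ * q₂ - g₂ * q₁) hf hrel
    (by subst e₁ e₂ e₃; linear_combination q₃ * h)
    (by subst e₁ e₂ e₃; linear_combination -q₂ * h)
  obtain ⟨b, b₁, b₂, b₃⟩ := exists_mul_eq_of_proportional (r₁ := p₂ * g₃ - p₃ * g₂)
    (r₂ := p₃ * g₁ - p₁ * g₃) (r₃ := p₁ * g₂ - p₂ * g₁) hf hrel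
    (by subst e₁ e₂ e₃; linear_combination -p₃ * h)
    (by subst e₁ e₂ e₃; linear_combination p₂ * h)
  refine ⟨a, b, ?_, ?_, ?_⟩ <;> refine mul_left_cancel₀ hf ?_
  · linear_combination h + p₁ * a₁ + q₁ * b₁ - g₂ * e₂ - g₃ * e₃
  · linear_combination p₂ * a₁ + q₂ * b₁ + g₂ * e₁
  · linear_combination p₃ * a₁ + q₃ * b₁ + g₃ * e₁

end HilbertBurch

/-! ### Tensor product of the Hilbert–Burch and Koszul complexes -/

section Cone

variable {R : Type*} [CommRing R]

/-- The first differential of the tensor product of a Hilbert–Burch and a Koszul complex. -/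
def coneMatrix₁ (f₁ f₂ f₃ g : R) : Matrix (Fin 1) (Fin 4) R := !![f₁, f₂, f₃, g]

/-- The second differential of the tensor product of a Hilbert–Burch and a Koszul complex. -/
def coneMatrix₂ (p₁ p₂ p₃ q₁ q₂ q₃ f₁ f₂ f₃ g : R) : Matrix (Fin 4) (Fin 5) R :=
  !![g, 0, 0, p₁, q₁; 0, g, 0, p₂, q₂; 0, 0, g, p₃, q₃; -f₁, -f₂, -f₃, 0, 0]

/-- The third differential of the tensor product of a Hilbert–Burch and a Koszul complex. -/
def coneMatrix₃ (p₁ p₂ p₃ q₁ q₂ q₃ g : R) : Matrix (Fin 5) (Fin 2) R :=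
  !![p₁, q₁; p₂, q₂; p₃, q₃; -g, 0; 0, -g]

lemma coneMatrix₁_apply (f₁ f₂ f₃ g : R) (v : Fin 4 → R) :
    (coneMatrix₁ f₁ f₂ f₃ g).mulVecLin v =
      ![f₁ * v 0 + f₂ * v 1 + f₃ * v 2 + g * v 3] := by
  ext i
  fin_cases i
  simp [coneMatrix₁, Matrix.mulVec, dotProduct, Fin.sum_univ_four]

lemma coneMatrix₂_apply (p₁ p₂ p₃ q₁ q₂ q₃ f₁ f₂ f₃ g : R) (v : Fin 5 → R) :
    (coneMatrix₂ p₁ p₂ p₃ q₁ q₂ q₃ f₁ f₂ f₃ g).mulVecLin v =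
      ![g * v 0 + p₁ * v 3 + q₁ * v 4, g * v 1 + p₂ * v 3 + q₂ * v 4,
        g * v 2 + p₃ * v 3 + q₃ * v 4, -(f₁ * v 0 + f₂ * v 1 + f₃ * v 2)] := by
  ext i
  fin_cases i <;> simp [coneMatrix₂, Matrix.mulVec, dotProduct, Fin.sum_univ_five]
  ring

lemma coneMatrix₃_apply (p₁ p₂ p₃ q₁ q₂ q₃ g : R) (v : Fin 2 → R) :
    (coneMatrix₃ p₁ p₂ p₃ q₁ q₂ q₃ g).mulVecLin v =
      ![p₁ * v 0 + q₁ * v 1, p₂ * v 0 + q₂ * v 1, p₃ * v 0 + q₃ * v 1, -(g * v 0), -(g * v 1)] := by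
  ext i
  fin_cases i <;> simp [coneMatrix₃, Matrix.mulVec, dotProduct, Fin.sum_univ_two]

variable [IsDomain R] {p₁ p₂ p₃ q₁ q₂ q₃ f₁ f₂ f₃ g : R}

/-- Cramer's rule with the nonzero minor f₁. -/
lemma combination_injective (e₁ : f₁ = p₂ * q₃ - p₃ * q₂) (hf : f₁ ≠ 0) {a b : R}
    (h₂ : p₂ * a + q₂ * b = 0) (h₃ : p₃ * a + q₃ * b = 0) : a = 0 ∧ b = 0 := by
  constructor <;> refine (mul_eq_zero.1 ?_).resolve_left hf
  · linear_combination q₃ * h₂ - q₂ * h₃ + a * e₁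
  · linear_combination p₂ * h₃ - p₃ * h₂ + b * e₁

theorem injective_coneMatrix₃ (e₁ : f₁ = p₂ * q₃ - p₃ * q₂) (hf : f₁ ≠ 0) :
    Function.Injective (coneMatrix₃ p₁ p₂ p₃ q₁ q₂ q₃ g).mulVecLin := by
  rw [injective_iff_map_eq_zero]
  intro v h
  rw [coneMatrix₃_apply] at h
  obtain ⟨ha, hb⟩ := combination_injective e₁ hf (congrFun h 1) (congrFun h 2)
  ext i
  fin_cases i
  · exact ha
  · exact hb

variable [UniqueFactorizationMonoid R]

/-- In a relation f·v + g v₃ = 0, regularity of g puts v₃ in (f₁, f₂, f₃), say v₃ = f·u. Then v + g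
u is a syzygy of the minors, hence a combination of the rows p and q. -/
theorem exact_coneMatrix₂_coneMatrix₁ (e₁ : f₁ = p₂ * q₃ - p₃ * q₂)
    (e₂ : f₂ = p₃ * q₁ - p₁ * q₃) (e₃ : f₃ = p₁ * q₂ - p₂ * q₁) (hf : f₁ ≠ 0)
    (hrel : ∀ d, d ∣ f₁ → d ∣ f₂ → d ∣ f₃ → IsUnit d)
    (hg : ∀ x, g * x ∈ Ideal.span {f₁, f₂, f₃} → x ∈ Ideal.span {f₁, f₂, f₃}) :
    Function.Exact (coneMatrix₂ p₁ p₂ p₃ q₁ q₂ q₃ f₁ f₂ f₃ g).mulVecLin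
      (coneMatrix₁ f₁ f₂ f₃ g).mulVecLin := by
  intro v
  rw [coneMatrix₁_apply]
  constructor
  · intro h
    replace h : f₁ * v 0 + f₂ * v 1 + f₃ * v 2 + g * v 3 = 0 := congrFun h 0
    have hv : v 3 ∈ Ideal.span {f₁, f₂, f₃} := by
      apply hg
      rw [show g * v 3 = -(v 0) * f₁ + (-(v 1) * f₂ + -(v 2) * f₃) by linear_combination h]
      refine add_mem (Ideal.mul_mem_left _ _ (Ideal.subset_span (by simp)))
        (add_mem (Ideal.mul_mem_left _ _ (Ideal.subset_span (by simp)))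
          (Ideal.mul_mem_left _ _ (Ideal.subset_span (by simp))))
    obtain ⟨u₁, u₂, u₃, hu⟩ := Submodule.mem_span_triple.1 hv
    simp only [smul_eq_mul] at hu
    obtain ⟨a, b, h₁, h₂, h₃⟩ := exists_combination_of_syzygy e₁ e₂ e₃ hf hrel
      (g₁ := v 0 + g * u₁) (g₂ := v 1 + g * u₂) (g₃ := v 2 + g * u₃)
      (by linear_combination h + g * hu)
    refine ⟨![-u₁, -u₂, -u₃, a, b], ?_⟩
    rw [coneMatrix₂_apply]
    ext i
    fin_cases i
    · simp; linear_combination -h₁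
    · simp; linear_combination -h₂
    · simp; linear_combination -h₃
    · simp; linear_combination hu
  · rintro ⟨w, rfl⟩
    rw [coneMatrix₂_apply]
    ext i
    fin_cases i
    simp
    subst e₁ e₂ e₃
    ring

/-- The last coordinate makes (v₀, v₁, v₂) a syzygy of the minors, equal to a p + b q. The others
then read (g a + v₃)p + (g b + v₄)q = 0, and independence of the rows determines v₃ and v₄. -/
theorem exact_coneMatrix₃_coneMatrix₂ (e₁ : f₁ = p₂ * q₃ - p₃ * q₂)
    (e₂ : f₂ = p₃ * q₁ - p₁ * q₃) (e₃ : f₃ = p₁ * q₂ - p₂ * q₁) (hf : f₁ ≠ 0)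
    (hrel : ∀ d, d ∣ f₁ → d ∣ f₂ → d ∣ f₃ → IsUnit d) :
    Function.Exact (coneMatrix₃ p₁ p₂ p₃ q₁ q₂ q₃ g).mulVecLin
      (coneMatrix₂ p₁ p₂ p₃ q₁ q₂ q₃ f₁ f₂ f₃ g).mulVecLin := by
  intro v
  rw [coneMatrix₂_apply]
  constructor
  · intro h
    have h0 : g * v 0 + p₁ * v 3 + q₁ * v 4 = 0 := congrFun h 0
    have h1 : g * v 1 + p₂ * v 3 + q₂ * v 4 = 0 := congrFun h 1
    have h2 : g * v 2 + p₃ * v 3 + q₃ * v 4 = 0 := congrFun h 2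
    have h3 : -(f₁ * v 0 + f₂ * v 1 + f₃ * v 2) = 0 := congrFun h 3
    obtain ⟨a, b, t₁, t₂, t₃⟩ := exists_combination_of_syzygy e₁ e₂ e₃ hf hrel (neg_eq_zero.1 h3)
    obtain ⟨ha, hb⟩ := combination_injective e₁ hf (a := g * a + v 3) (b := g * b + v 4)
      (by rw [t₂] at h1; linear_combination h1) (by rw [t₃] at h2; linear_combination h2)
    refine ⟨![a, b], ?_⟩
    rw [coneMatrix₃_apply]
    ext i
    fin_cases i
    · simp [t₁]
    · simp [t₂]
    · simp [t₃]
    · simp; linear_combination -ha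
    · simp; linear_combination -hb
  · rintro ⟨w, rfl⟩
    rw [coneMatrix₃_apply]
    subst e₁ e₂ e₃
    ext i
    fin_cases i <;> simp <;> ring

end Cone

/-! ### The minimal graded free resolution of type 1, 4, 5, 2 -/

section Resolution

universe u

variable {k : Type u} [Field k] {C : Finset ℕ}

/-- The Betti numbers of the resolution. -/
abbrev bettiNumbers (i : ℕ) : ℕ := [1, 4, 5, 2].getD i 0

/-- The matrices of the differentials. -/
def resolutionMatrix {R : Type*} [CommRing R] (p₁ p₂ p₃ q₁ q₂ q₃ f₁ f₂ f₃ g : R) :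
    ∀ i, Matrix (Fin (bettiNumbers i)) (Fin (bettiNumbers (i + 1))) R
  | 0 => coneMatrix₁ f₁ f₂ f₃ g
  | 1 => coneMatrix₂ p₁ p₂ p₃ q₁ q₂ q₃ f₁ f₂ f₃ g
  | 2 => coneMatrix₃ p₁ p₂ p₃ q₁ q₂ q₃ g
  | _ + 3 => 0

/-- The degrees of the basis vectors. -/
def resolutionDegree (n₁ n₂ n₃ n m m' : ℕ) : ∀ i, Fin (bettiNumbers i) → ℕ
  | 0 => (![0] : Fin 1 → ℕ)
  | 1 => (![n₁, n₂, n₃, n] : Fin 4 → ℕ)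
  | 2 => (![n₁ + n, n₂ + n, n₃ + n, m, m'] : Fin 5 → ℕ)
  | 3 => (![m + n, m' + n] : Fin 2 → ℕ)
  | _ + 4 => fun _ => 0

instance (n : ℕ) : IsEmpty (Fin (bettiNumbers (n + 4))) :=
  inferInstanceAs (IsEmpty (Fin 0))

lemma isHomogeneous_neg {f : PolyRing k C} {n : ℕ} (h : IsHomogeneous k C f n) :
    IsHomogeneous k C (-f) n :=
  (MvPolynomial.weightedHomogeneousSubmodule k (fun c : C => (c : ℕ)) n).neg_mem h

/-- The minimal graded free resolution of `k[C]` when `I_C` is generated by the maximal minors of a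
homogeneous `2 × 3` matrix and a homogeneous polynomial that is a nonzerodivisor modulo them. -/
noncomputable def resolutionOfMinors {p₁ p₂ p₃ q₁ q₂ q₃ f₁ f₂ f₃ g : PolyRing k C}
    (e₁ : f₁ = p₂ * q₃ - p₃ * q₂) (e₂ : f₂ = p₃ * q₁ - p₁ * q₃) (e₃ : f₃ = p₁ * q₂ - p₂ * q₁)
    (hf : f₁ ≠ 0) (hrel : ∀ d, d ∣ f₁ → d ∣ f₂ → d ∣ f₃ → IsUnit d)
    (hg : ∀ x, g * x ∈ Ideal.span {f₁, f₂, f₃} → x ∈ Ideal.span {f₁, f₂, f₃})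
    (hI : definingIdeal k C = Ideal.span {f₁, f₂, f₃, g})
    {a₁ a₂ a₃ a₁' a₂' a₃' n₁ n₂ n₃ n m m' : ℕ}
    (hp₁ : IsHomogeneous k C p₁ a₁) (hp₂ : IsHomogeneous k C p₂ a₂) (hp₃ : IsHomogeneous k C p₃ a₃)
    (hq₁ : IsHomogeneous k C q₁ a₁') (hq₂ : IsHomogeneous k C q₂ a₂')
    (hq₃ : IsHomogeneous k C q₃ a₃') (hf₁ : IsHomogeneous k C f₁ n₁)
    (hf₂ : IsHomogeneous k C f₂ n₂) (hf₃ : IsHomogeneous k C f₃ n₃) (hgn : IsHomogeneous k C g n)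
    (hm : m = a₁ + n₁ ∧ m = a₂ + n₂ ∧ m = a₃ + n₃)
    (hm' : m' = a₁' + n₁ ∧ m' = a₂' + n₂ ∧ m' = a₃' + n₃)
    (hmin : ∀ x ∈ ({p₁, p₂, p₃, q₁, q₂, q₃, f₁, f₂, f₃, g} : Set (PolyRing k C)),
      x ∈ Ideal.span (Set.range (MvPolynomial.X : C → PolyRing k C))) :
    MinimalGradedFreeResolution k C fun i => [1, 4, 5, 2].getD i 0 where
  deg := resolutionDegree n₁ n₂ n₃ n m m'
  d i := (resolutionMatrix p₁ p₂ p₃ q₁ q₂ q₃ f₁ f₂ f₃ g i).mulVecLin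
  ε := (Submodule.mkQ (definingIdeal k C)).comp (LinearMap.proj (0 : Fin 1))
  surjective_ε := by
    intro x
    obtain ⟨y, rfl⟩ := Submodule.mkQ_surjective _ x
    exact ⟨fun _ => y, rfl⟩
  exact_ε := by
    intro v
    change (definingIdeal k C).mkQ (v (0 : Fin 1)) = 0 ↔
      v ∈ Set.range (coneMatrix₁ f₁ f₂ f₃ g).mulVecLin
    rw [Submodule.mkQ_apply, Submodule.Quotient.mk_eq_zero, hI]
    constructor
    · intro h
      obtain ⟨a, y, hy, h⟩ := Submodule.mem_span_insert.1 h
      obtain ⟨b, c, d, rfl⟩ := Submodule.mem_span_triple.1 hy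
      refine ⟨![a, b, c, d], ?_⟩
      rw [coneMatrix₁_apply]
      ext i : 1
      obtain rfl : i = (0 : Fin 1) := Subsingleton.elim _ _
      rw [h]
      simp
      ring
    · rintro ⟨w, rfl⟩
      rw [coneMatrix₁_apply]
      simp only [Matrix.cons_val_zero]
      refine add_mem (add_mem (add_mem ?_ ?_) ?_) ?_ <;>
        exact Ideal.mul_mem_right _ _ (Ideal.subset_span (by simp))
  exact_d
    | 0 => exact_coneMatrix₂_coneMatrix₁ e₁ e₂ e₃ hf hrel hg
    | 1 => exact_coneMatrix₃_coneMatrix₂ e₁ e₂ e₃ hf hrel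
    | 2 => by
      intro v
      constructor
      · intro h
        exact ⟨0, by rw [map_zero]; exact (injective_coneMatrix₃ e₁ hf (h.trans (map_zero _).symm)).symm⟩
      · rintro ⟨w, rfl⟩
        rw [Subsingleton.elim w 0, map_zero, map_zero]
    | n + 3 => fun v => by
      rw [Subsingleton.elim v 0]
      exact ⟨fun _ => ⟨0, map_zero _⟩, fun _ => map_zero _⟩
  homogeneous_ε := by
    intro j
    obtain rfl : j = (0 : Fin 1) := Subsingleton.elim (α := Fin 1) _ _
    exact ⟨1, MvPolynomial.isWeightedHomogeneous_one _ _, rfl⟩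
  homogeneous_d := by
    intro i j r h
    rw [Matrix.mulVecLin_apply, Matrix.mulVec_single_one] at h ⊢
    simp only [Matrix.col_apply] at h ⊢
    match i, j, r, h with
    | 0, (j : Fin 4), (r : Fin 1), h =>
      fin_cases r
      fin_cases j
      · exact ⟨n₁, rfl, hf₁⟩
      · exact ⟨n₂, rfl, hf₂⟩
      · exact ⟨n₃, rfl, hf₃⟩
      · exact ⟨n, rfl, hgn⟩
    | 1, (j : Fin 5), (r : Fin 4), h =>
      fin_cases j <;> fin_cases r
      any_goals exact absurd rfl h
      · exact ⟨n, add_comm _ _, hgn⟩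
      · exact ⟨n₁, rfl, isHomogeneous_neg hf₁⟩
      · exact ⟨n, add_comm _ _, hgn⟩
      · exact ⟨n₂, rfl, isHomogeneous_neg hf₂⟩
      · exact ⟨n, add_comm _ _, hgn⟩
      · exact ⟨n₃, rfl, isHomogeneous_neg hf₃⟩
      · exact ⟨a₁, hm.1.symm, hp₁⟩
      · exact ⟨a₂, hm.2.1.symm, hp₂⟩
      · exact ⟨a₃, hm.2.2.symm, hp₃⟩
      · exact ⟨a₁', hm'.1.symm, hq₁⟩
      · exact ⟨a₂', hm'.2.1.symm, hq₂⟩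
      · exact ⟨a₃', hm'.2.2.symm, hq₃⟩
    | 2, (j : Fin 2), (r : Fin 5), h =>
      obtain ⟨h₁, h₂, h₃⟩ := hm
      obtain ⟨h₁', h₂', h₃'⟩ := hm'
      fin_cases j <;> fin_cases r
      any_goals exact absurd rfl h
      · exact ⟨a₁, show a₁ + (n₁ + n) = m + n by omega, hp₁⟩
      · exact ⟨a₂, show a₂ + (n₂ + n) = m + n by omega, hp₂⟩
      · exact ⟨a₃, show a₃ + (n₃ + n) = m + n by omega, hp₃⟩
      · exact ⟨n, add_comm _ _, isHomogeneous_neg hgn⟩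
      · exact ⟨a₁', show a₁' + (n₁ + n) = m' + n by omega, hq₁⟩
      · exact ⟨a₂', show a₂' + (n₂ + n) = m' + n by omega, hq₂⟩
      · exact ⟨a₃', show a₃' + (n₃ + n) = m' + n by omega, hq₃⟩
      · exact ⟨n, add_comm _ _, isHomogeneous_neg hgn⟩
    | i + 3, j, r, h => exact isEmptyElim j
  minimal := by
    simp only [Set.mem_insert_iff, Set.mem_singleton_iff, forall_eq_or_imp, forall_eq] at hmin
    obtain ⟨mp₁, mp₂, mp₃, mq₁, mq₂, mq₃, mf₁, mf₂, mf₃, mg⟩ := hmin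
    have hmem : ∀ i r j, resolutionMatrix p₁ p₂ p₃ q₁ q₂ q₃ f₁ f₂ f₃ g i r j ∈
        Ideal.span (Set.range (MvPolynomial.X : C → PolyRing k C)) := by
      intro i r j
      match i, r, j with
      | 0, (r : Fin 1), (j : Fin 4) =>
        fin_cases r
        fin_cases j
        · exact mf₁
        · exact mf₂
        · exact mf₃
        · exact mg
      | 1, (r : Fin 4), (j : Fin 5) =>
        fin_cases j <;> fin_cases r
        all_goals first
          | exact zero_mem _
          | exact mg
          | exact neg_mem mf₁
          | exact neg_mem mf₂
          | exact neg_mem mf₃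
          | exact mp₁
          | exact mp₂
          | exact mp₃
          | exact mq₁
          | exact mq₂
          | exact mq₃
      | 2, (r : Fin 5), (j : Fin 2) =>
        fin_cases j <;> fin_cases r
        all_goals first
          | exact zero_mem _
          | exact neg_mem mg
          | exact mp₁
          | exact mp₂
          | exact mp₃
          | exact mq₁
          | exact mq₂
          | exact mq₃
      | i + 3, r, j => exact isEmptyElim j
    intro i v r
    rw [Matrix.mulVecLin_apply, Matrix.mulVec, dotProduct]
    exact sum_mem fun j _ => Ideal.mul_mem_right _ _ (hmem i r j)

end Resolution

/-! ### Minimal number of generators -/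

section NumberOfGenerators

/-- The minimal number of generators of an ideal given by generators whose syzygies all have
coefficients in a maximal ideal. -/
theorem spanFinrank_eq_of_syzygies_mem {R : Type*} [CommRing R] [IsDomain R] (𝔪 : Ideal R)
    [h𝔪 : 𝔪.IsMaximal] {n : ℕ} (f : Fin n → R)
    (hsyz : ∀ c : Fin n → R, ∑ i, c i * f i = 0 → ∀ i, c i ∈ 𝔪) :
    (Ideal.span (Set.range f)).spanFinrank = n := by
  have hfg : (Ideal.span (Set.range f)).FG := Submodule.fg_span (Set.finite_range f)
  apply le_antisymm
  · refine (Submodule.spanFinrank_span_le_ncard_of_finite (Set.finite_range f)).trans ?_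
    rw [← Set.image_univ]
    refine (Set.ncard_image_le Set.finite_univ).trans ?_
    simp
  · obtain ⟨s, hs, hspan⟩ := Submodule.FG.exists_span_finset_card_eq_spanFinrank hfg
    rw [← hs]
    have hA : ∀ x : s, ∃ c : Fin n → R, ∑ i, c i * f i = x := fun x =>
      (Ideal.mem_span_range_iff_exists_fun).1 (hspan ▸ Submodule.subset_span x.2)
    have hB : ∀ i, ∃ c : s → R, ∑ x, c x * (x : R) = f i := by
      intro i
      have h1 : f i ∈ Ideal.span (Set.range (Subtype.val : s → R)) := by
        rw [Subtype.range_coe]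
        have h2 : f i ∈ Ideal.span (Set.range f) := Submodule.subset_span (Set.mem_range_self i)
        rwa [← hspan] at h2
      exact (Ideal.mem_span_range_iff_exists_fun).1 h1
    choose A hA using hA
    choose B hB using hB
    -- Expressing the fᵢ through `s` and back gives a syzygy with coefficients BA − 1. Thus BA ≡ 1
    -- modulo 𝔪, and rank n forces at least n elements in `s`.
    have key : ∀ i j, (∑ x, B i x * A x j) - (if i = j then 1 else 0) ∈ 𝔪 := by
      intro i
      apply hsyz
      simp only [sub_mul, Finset.sum_sub_distrib, Finset.sum_mul, ite_mul, one_mul, zero_mul,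
        Finset.sum_ite_eq, Finset.mem_univ, if_true]
      rw [Finset.sum_comm, sub_eq_zero]
      simp only [mul_assoc, ← Finset.mul_sum, hA, hB]
    let := Ideal.Quotient.field 𝔪
    let π := Ideal.Quotient.mk 𝔪
    have hmul : (Matrix.of fun i x => π (B i x)) * (Matrix.of fun x j => π (A x j)) =
        (1 : Matrix (Fin n) (Fin n) (R ⧸ 𝔪)) := by
      ext i j
      rw [Matrix.mul_apply, Matrix.one_apply]
      have := Ideal.Quotient.eq_zero_iff_mem.2 (key i j)
      rw [map_sub, sub_eq_zero, map_sum] at this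
      simpa [apply_ite] using this
    have h1 := Matrix.rank_mul_le_left (Matrix.of fun i x => π (B i x))
      (Matrix.of fun x j => π (A x j))
    rw [hmul, Matrix.rank_one, Fintype.card_fin] at h1
    simpa using h1.trans (Matrix.rank_le_card_width _)

end NumberOfGenerators

/-! ### Height of the defining ideal -/

section Height

universe u

variable {k : Type u} [Field k] {C : Finset ℕ}

lemma constantCoeff_eq_zero_of_mem_definingIdeal (hC : ∀ c ∈ C, 0 < c) {F : PolyRing k C}
    (hF : F ∈ definingIdeal k C) : MvPolynomial.constantCoeff F = 0 := by
  have h : (Polynomial.constantCoeff (R := k)).comp (monomialMap k C).toRingHom =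
      MvPolynomial.constantCoeff := by
    ext c
    · simp [monomialMap]
    · simp [monomialMap, Polynomial.coeff_X_pow, (hC c c.2).ne]
  rw [← h, RingHom.comp_apply]
  have : (monomialMap k C).toRingHom F = 0 := hF
  rw [this, map_zero]

lemma constantCoeff_ker_isMaximal :
    (RingHom.ker (MvPolynomial.constantCoeff : PolyRing k C →+* k)).IsMaximal :=
  RingHom.ker_isMaximal_of_surjective _ fun a => ⟨MvPolynomial.C a, by simp⟩

/-- The defining ideal of a monomial curve in affine `4`-space has height `3`. -/
theorem height_definingIdeal (hC : ∀ c ∈ C, 0 < c) (e : Fin 4 ≃ C) :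
    (definingIdeal k C).height = 3 := by
  have hpos : ∀ i, 0 < (e i : ℕ) := fun i => hC _ (e i).2
  have hI : (definingIdeal k C).IsPrime := definingIdeal_isPrime
  apply le_antisymm
  · set 𝔪 := RingHom.ker (MvPolynomial.constantCoeff : PolyRing k C →+* k) with h𝔪
    have : 𝔪.IsPrime := constantCoeff_ker_isMaximal.isPrime
    -- The defining ideal lies strictly below a maximal ideal of height at most 4, since no variable
    -- maps to zero.
    have hlt : definingIdeal k C < 𝔪 := by
      refine lt_of_le_of_ne (fun F hF => constantCoeff_eq_zero_of_mem_definingIdeal hC hF) ?_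
      intro h
      have hX : (MvPolynomial.X (e 0) : PolyRing k C) ∈ 𝔪 := by simp [h𝔪, RingHom.mem_ker]
      rw [← h, definingIdeal, RingHom.mem_ker] at hX
      simp [monomialMap] at hX
    have h1 := Ideal.height_add_one_le_of_lt_of_isPrime hlt
    have h2 : (𝔪.height : WithBot ℕ∞) ≤ ringKrullDim (PolyRing k C) :=
      Ideal.height_le_ringKrullDim_of_isPrime
    rw [MvPolynomial.ringKrullDim_of_isNoetherianRing, ringKrullDim_eq_zero_of_field, zero_add,
      ← Nat.card_congr e, Nat.card_fin] at h2
    have h3 : 𝔪.height ≤ 4 := WithBot.coe_le_coe.1 h2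
    have h4 : (definingIdeal k C).height + 1 ≤ 3 + 1 := h1.trans h3
    exact (ENat.add_le_add_iff_right (by simp)).1 h4
  · let P := toricIdeal k e (![(e 0, 0, 0), (e 1, 0, 0), (0, 1, 0), (0, 0, 1)] :
      Fin 4 → ℕ × ℕ × ℕ)
    let Q := toricIdeal k e (![(e 0, 0), (e 1, 0), (e 2, 0), (0, 1)] : Fin 4 → ℕ × ℕ)
    have hP : ⊥ < P := by
      rw [bot_lt_iff_ne_bot]
      intro h
      have : mono k e ![e 1, 0, 0, 0] - mono k e ![0, e 0, 0, 0] ∈ P := by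
        rw [mono_sub_mono_mem_toricIdeal]
        simp only [weight, Fin.sum_univ_four]
        simp [mul_comm]
      rw [h, Ideal.mem_bot, sub_eq_zero] at this
      simpa [(hpos 1).ne'] using congrFun (mono_injective e this) 0
    have hPQ : P < Q := by
      rw [lt_iff_le_not_ge]
      refine ⟨toricIdeal_le e _ _ fun u v h => ?_, fun h => ?_⟩
      · rw [mono_sub_mono_mem_toricIdeal]
        simp only [weight, Fin.sum_univ_four] at h ⊢
        simp at h ⊢
        simp [h]
      · have h2 : mono k e ![e 2, 0, 0, 0] - mono k e ![0, 0, e 0, 0] ∈ Q := by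
          rw [mono_sub_mono_mem_toricIdeal]
          simp only [weight, Fin.sum_univ_four]
          simp [mul_comm]
        have := h h2
        rw [mono_sub_mono_mem_toricIdeal] at this
        simp only [weight, Fin.sum_univ_four] at this
        simp at this
        have := hpos 0
        have := hpos 2
        omega
    have hQI : Q < definingIdeal k C := by
      rw [definingIdeal_eq_toricIdeal e, lt_iff_le_not_ge]
      refine ⟨toricIdeal_le e _ _ fun u v h => ?_, fun h => ?_⟩
      · rw [mono_sub_mono_mem_toricIdeal]
        simp only [weight, Fin.sum_univ_four] at h ⊢
        simp at h ⊢
        simp [h]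
      · have h2 : mono k e ![e 3, 0, 0, 0] - mono k e ![0, 0, 0, e 0] ∈
            toricIdeal k e fun i => (e i : ℕ) := by
          rw [mono_sub_mono_mem_toricIdeal]
          simp only [weight, Fin.sum_univ_four]
          simp [mul_comm]
        have := h h2
        rw [mono_sub_mono_mem_toricIdeal] at this
        simp only [weight, Fin.sum_univ_four] at this
        simp at this
        have := hpos 0
        have := hpos 3
        omega
    have h1 := Ideal.height_add_one_le_of_lt_of_isPrime hP
    have h2 := Ideal.height_add_one_le_of_lt_of_isPrime hPQ
    have h3 := Ideal.height_add_one_le_of_lt_of_isPrime hQI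
    rw [Ideal.height_bot] at h1
    calc (3 : ℕ∞) = 0 + 1 + 1 + 1 := by norm_num
      _ ≤ P.height + 1 + 1 := by gcongr
      _ ≤ Q.height + 1 := by gcongr
      _ ≤ _ := h3

end Height

/-! ### The toric ideal of three weights has no common factor -/

section CommonDivisors

variable {k σ ι : Type*} [Field k] [Fintype ι]

lemma degreeOf_mono (e : ι ≃ σ) (v : ι → ℕ) (i : ι) :
    MvPolynomial.degreeOf (e i) (mono k e v) = v i := by
  rw [mono, MvPolynomial.degreeOf_monomial_eq _ _ one_ne_zero, Finsupp.mapDomain_apply e.injective]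
  rfl

/-- A divisor of a binomial does not involve the variables absent from it. -/
lemma degreeOf_eq_zero_of_dvd_binomial (e : ι ≃ σ) {u v : ι → ℕ} (huv : u ≠ v) {i : ι}
    (hu : u i = 0) (hv : v i = 0) {d : MvPolynomial σ k} (h : d ∣ mono k e u - mono k e v) :
    d.degreeOf (e i) = 0 := by
  obtain ⟨c, hc⟩ := h
  have hne : mono k e u - mono k e v ≠ 0 := sub_ne_zero.2 ((mono_injective e).ne huv)
  have h0 : (mono k e u - mono k e v).degreeOf (e i) = 0 := by
    have := MvPolynomial.degreeOf_sub_le (e i) (mono k e u) (mono k e v)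
    rw [degreeOf_mono, degreeOf_mono, hu, hv] at this
    simpa using this
  rw [hc] at hne h0
  rw [MvPolynomial.degreeOf_mul_eq (left_ne_zero_of_mul hne) (right_ne_zero_of_mul hne)] at h0
  omega

/-- The toric ideal of a weight on three variables has no common divisor. -/
lemma isUnit_of_dvd_toricIdeal (e : Fin 4 ≃ σ) {b₁ b₂ b₃ : ℕ}
    (h₂ : 0 < b₂) (h₃ : 0 < b₃) {d : MvPolynomial σ k}
    (hd : ∀ f ∈ toricIdeal k e (![(1, 0), (0, b₁), (0, b₂), (0, b₃)] : Fin 4 → ℕ × ℕ), d ∣ f) :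
    IsUnit d := by
  have h12 : d ∣ mono k e ![0, b₂, 0, 0] - mono k e ![0, 0, b₁, 0] := by
    apply hd
    rw [mono_sub_mono_mem_toricIdeal]
    simp only [weight, Fin.sum_univ_four]
    simp [mul_comm]
  have h13 : d ∣ mono k e ![0, b₃, 0, 0] - mono k e ![0, 0, 0, b₁] := by
    apply hd
    rw [mono_sub_mono_mem_toricIdeal]
    simp only [weight, Fin.sum_univ_four]
    simp [mul_comm]
  have h23 : d ∣ mono k e ![0, 0, b₃, 0] - mono k e ![0, 0, 0, b₂] := by
    apply hd
    rw [mono_sub_mono_mem_toricIdeal]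
    simp only [weight, Fin.sum_univ_four]
    simp [mul_comm]
  have n12 : ![0, b₂, 0, 0] ≠ ![0, 0, b₁, 0] := fun h => by simpa [h₂.ne'] using congrFun h 1
  have n13 : ![0, b₃, 0, 0] ≠ ![0, 0, 0, b₁] := fun h => by simpa [h₃.ne'] using congrFun h 1
  have n23 : ![0, 0, b₃, 0] ≠ ![0, 0, 0, b₂] := fun h => by simpa [h₃.ne'] using congrFun h 2
  -- Every variable is missing from at least one of the three binomials, so d involves no variable.
  have hdeg : ∀ i, d.degreeOf (e i) = 0 := by
    intro i
    fin_cases i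
    · exact degreeOf_eq_zero_of_dvd_binomial e n12 rfl rfl h12
    · exact degreeOf_eq_zero_of_dvd_binomial e n23 rfl rfl h23
    · exact degreeOf_eq_zero_of_dvd_binomial e n13 rfl rfl h13
    · exact degreeOf_eq_zero_of_dvd_binomial e n12 rfl rfl h12
  have hvars : d.vars = ∅ := by
    ext j
    obtain ⟨i, rfl⟩ := e.surjective j
    have := hdeg i
    classical
    rw [MvPolynomial.degreeOf_def, Multiset.count_eq_zero] at this
    simpa [MvPolynomial.vars_def] using this
  rw [MvPolynomial.vars_eq_empty_iff_eq_C] at hvars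
  rw [hvars]
  refine (IsUnit.mk0 _ ?_).map MvPolynomial.C
  intro h0
  rw [h0, map_zero] at hvars
  rw [hvars, zero_dvd_iff, sub_eq_zero] at h12
  exact n12 (mono_injective e h12)

end CommonDivisors

/-! ### Ext¹(A/𝔪, A) as homomorphisms 𝔪 → A modulo multiplications -/

section ExtOne

universe u

open CategoryTheory CategoryTheory.Abelian

variable {A : Type u} [CommRing A]

/-- The short exact sequence `0 → 𝔪 → A → A ⧸ 𝔪 → 0`. -/
noncomputable def idealShortComplex (𝔪 : Ideal A) : ShortComplex (ModuleCat.{u} A) :=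
  ShortComplex.mk (ModuleCat.ofHom 𝔪.subtype) (ModuleCat.ofHom 𝔪.mkQ) (by
    ext x
    exact Ideal.Quotient.eq_zero_iff_mem.2 x.2)

lemma idealShortComplex_shortExact (𝔪 : Ideal A) : (idealShortComplex 𝔪).ShortExact where
  exact := by
    rw [ShortComplex.ShortExact.moduleCat_exact_iff_function_exact]
    exact LinearMap.exact_subtype_mkQ 𝔪
  mono_f := (ModuleCat.mono_iff_injective _).2 𝔪.injective_subtype
  epi_g := (ModuleCat.epi_iff_surjective _).2 𝔪.mkQ_surjective

/-- The connecting map `Hom(𝔪, A) → Ext¹(A ⧸ 𝔪, A)`. -/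
noncomputable def connectingMap (𝔪 : Ideal A) :
    (𝔪 →ₗ[A] A) →ₗ[A] Ext (ModuleCat.of A (A ⧸ 𝔪)) (ModuleCat.of A A) 1 where
  toFun φ := (idealShortComplex_shortExact 𝔪).extClass.comp
    (Ext.mk₀ (ModuleCat.ofHom φ : ModuleCat.of A 𝔪 ⟶ ModuleCat.of A A)) (add_zero 1)
  map_add' φ ψ := by
    have h : (Ext.mk₀ (ModuleCat.ofHom (φ + ψ)) : Ext (idealShortComplex 𝔪).X₁ (ModuleCat.of A A) 0)
        = Ext.mk₀ (ModuleCat.ofHom φ) + Ext.mk₀ (ModuleCat.ofHom ψ) := Ext.mk₀_add _ _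
    exact (congrArg (fun y => Ext.comp _ y (add_zero 1)) h).trans (Ext.comp_add _ _ _ _)
  map_smul' a φ := by
    have h : (Ext.mk₀ (ModuleCat.ofHom (a • φ)) : Ext (idealShortComplex 𝔪).X₁ (ModuleCat.of A A) 0)
        = a • Ext.mk₀ (ModuleCat.ofHom φ) := Ext.mk₀_smul a _
    exact (congrArg (fun y => Ext.comp _ y (add_zero 1)) h).trans (Ext.comp_smul _ _ _ _)

/-- A is projective, so Ext¹(A, A) = 0 in the long exact sequence. -/
lemma connectingMap_surjective (𝔪 : Ideal A) : Function.Surjective (connectingMap 𝔪) := by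
  intro x
  have : Projective (idealShortComplex 𝔪).X₂ :=
    ModuleCat.projective_of_categoryTheory_projective (ModuleCat.of A A)
  obtain ⟨y, hy⟩ := Ext.contravariant_sequence_exact₃ (idealShortComplex_shortExact 𝔪) _ x
    (Ext.eq_zero_of_projective _) (add_zero 1)
  obtain ⟨φ, rfl⟩ := Ext.mk₀_bijective _ _ |>.2 y
  exact ⟨φ.hom, hy⟩

/-- By exactness the kernel consists of restrictions of endomorphisms of A, and these are
multiplications by the image of 1. -/
lemma connectingMap_eq_zero_iff (𝔪 : Ideal A) (φ : 𝔪 →ₗ[A] A) :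
    connectingMap 𝔪 φ = 0 ↔ ∃ a : A, ∀ x : 𝔪, φ x = a * x := by
  constructor
  · intro h
    obtain ⟨y, hy⟩ := Ext.contravariant_sequence_exact₁ (idealShortComplex_shortExact 𝔪) _ _
      (add_zero 1) h
    obtain ⟨ψ, rfl⟩ := Ext.mk₀_bijective _ _ |>.2 y
    rw [Ext.mk₀_comp_mk₀] at hy
    have h2 := (Ext.mk₀_bijective _ _).1 hy
    refine ⟨ψ.hom (1 : A), fun x => ?_⟩
    have h3 := congrArg (fun f => f.hom x) h2
    change ψ.hom (x : A) = φ x at h3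
    rw [← h3]
    have h4 : ψ.hom ((x : A) * (1 : A) : A) = (x : A) * ψ.hom (1 : A) :=
      ψ.hom.map_smul (x : A) (1 : A)
    exact (congrArg ψ.hom (mul_one (x : A)).symm).trans (h4.trans (mul_comm _ _))
  · rintro ⟨a, ha⟩
    obtain ⟨ψ, hψ⟩ : ∃ ψ : (idealShortComplex 𝔪).X₂ ⟶ ModuleCat.of A A,
        (ModuleCat.ofHom φ : (idealShortComplex 𝔪).X₁ ⟶ ModuleCat.of A A) =
          (idealShortComplex 𝔪).f ≫ ψ := by
      refine ⟨ModuleCat.ofHom (LinearMap.mulLeft A a), ?_⟩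
      ext x
      exact ha x
    change (idealShortComplex_shortExact 𝔪).extClass.comp (Ext.mk₀ (ModuleCat.ofHom φ))
      (add_zero 1) = 0
    rw [hψ, ← Ext.mk₀_comp_mk₀, ShortComplex.ShortExact.extClass_comp_assoc]

/-- The length of `Ext¹(A ⧸ 𝔪, A)` can be computed by homomorphisms `𝔪 → A` modulo multiplications
by elements of `A`. -/
theorem typeAt_eq_length {V : Type*} [AddCommGroup V] [Module A V] (𝔪 : Ideal A)
    (Φ : (𝔪 →ₗ[A] A) →ₗ[A] V) (hΦ : Function.Surjective Φ)
    (hker : ∀ φ, Φ φ = 0 ↔ ∃ a : A, ∀ x : 𝔪, φ x = a * x) : typeAt 𝔪 = Module.length A V := by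
  have h : LinearMap.ker (connectingMap 𝔪) = LinearMap.ker Φ := by
    ext φ
    rw [LinearMap.mem_ker, LinearMap.mem_ker, connectingMap_eq_zero_iff, hker]
  rw [typeAt]
  exact (((connectingMap 𝔪).quotKerEquivOfSurjective (connectingMap_surjective 𝔪)).symm.trans
    ((Submodule.quotEquivOfEq _ _ h).trans (Φ.quotKerEquivOfSurjective hΦ))).length_eq

end ExtOne

/-! ### The Cohen–Macaulay type as a count of maximal Apéry elements -/

section CohenMacaulayType

universe u

variable {k : Type u} [Field k] {C : Finset ℕ}

lemma X_pow_mem_semigroupRing {n : ℕ} (hn : n ∈ semigroup C) :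
    (Polynomial.X : Polynomial k) ^ n ∈ semigroupRing k C := by
  induction hn using AddSubmonoid.closure_induction with
  | mem c hc => exact ⟨MvPolynomial.X ⟨c, hc⟩, by simp [monomialMap]⟩
  | zero => simp
  | add a b _ _ ha hb => rw [pow_add]; exact mul_mem ha hb

/-- The semigroup ring consists of the polynomials with exponents in the semigroup. -/
lemma mem_semigroupRing_iff {p : Polynomial k} :
    p ∈ semigroupRing k C ↔ ∀ n, p.coeff n ≠ 0 → n ∈ semigroup C := by
  constructor
  · rintro ⟨F, rfl⟩
    change ∀ n, (monomialMap k C F).coeff n ≠ 0 → n ∈ semigroup C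
    induction F using MvPolynomial.induction_on with
    | C a =>
      intro n hn
      simp only [monomialMap, MvPolynomial.aeval_C, Polynomial.algebraMap_eq, Polynomial.coeff_C] at hn
      obtain rfl : n = 0 := by
        by_contra h
        simp [h] at hn
      exact zero_mem _
    | add p q hp hq =>
      intro n hn
      rw [map_add, Polynomial.coeff_add] at hn
      by_cases h : (monomialMap k C p).coeff n = 0
      · exact hq n fun h' => hn (by rw [h, h', add_zero])
      · exact hp n h
    | mul_X p c hp =>
      intro n hn
      rw [map_mul, show monomialMap k C (MvPolynomial.X c) = Polynomial.X ^ (c : ℕ) by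
        simp [monomialMap], Polynomial.coeff_mul_X_pow'] at hn
      split_ifs at hn with h
      · rw [← Nat.sub_add_cancel h]
        exact add_mem (hp _ hn) (AddSubmonoid.subset_closure c.2)
      · exact absurd rfl hn
  · intro h
    rw [p.as_sum_support_C_mul_X_pow]
    refine sum_mem fun n hn => ?_
    rw [← Polynomial.smul_eq_C_mul]
    exact Subalgebra.smul_mem _ (X_pow_mem_semigroupRing (h n (Polynomial.mem_support_iff.1 hn))) _

/-- The monomial of exponent `n` of the semigroup ring. -/
noncomputable def monomialOf (k : Type u) [Field k] {C : Finset ℕ} (n : semigroup C) :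
    semigroupRing k C :=
  ⟨Polynomial.X ^ (n : ℕ), X_pow_mem_semigroupRing n.2⟩

lemma monomialOf_ne_zero (n : semigroup C) : monomialOf k n ≠ 0 := fun h =>
  pow_ne_zero (n : ℕ) Polynomial.X_ne_zero (congrArg Subtype.val h)

lemma coe_monomialOf (n : semigroup C) :
    (monomialOf k n : Polynomial k) = Polynomial.X ^ (n : ℕ) := rfl

lemma coeff_mem_semigroup (h : semigroupRing k C) {n : ℕ} (hn : (h : Polynomial k).coeff n ≠ 0) :
    n ∈ semigroup C :=
  mem_semigroupRing_iff.1 h.2 n hn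

lemma mem_irrelevantIdeal_iff (h : semigroupRing k C) :
    h ∈ irrelevantIdeal k C ↔ (h : Polynomial k).coeff 0 = 0 := Iff.rfl

/-- Divisibility by a monomial is decided by the exponents. -/
lemma monomialOf_dvd_iff (c : semigroup C) (h : semigroupRing k C) :
    monomialOf k c ∣ h ↔
      ∀ n, (h : Polynomial k).coeff n ≠ 0 → ∃ s ∈ semigroup C, n = c + s := by
  constructor
  · rintro ⟨q, rfl⟩ n hn
    rw [Subalgebra.coe_mul, coe_monomialOf, Polynomial.coeff_X_pow_mul'] at hn
    split_ifs at hn with h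
    · exact ⟨n - c, coeff_mem_semigroup q hn, by omega⟩
    · exact absurd rfl hn
  · intro H
    obtain ⟨q, hq⟩ : (Polynomial.X : Polynomial k) ^ (c : ℕ) ∣ h := by
      rw [Polynomial.X_pow_dvd_iff]
      intro d hd
      by_contra hne
      obtain ⟨s, -, hs⟩ := H d hne
      omega
    refine ⟨⟨q, mem_semigroupRing_iff.2 fun n hn => ?_⟩, Subtype.ext hq⟩
    obtain ⟨s, hs, e⟩ := H (n + c) (by rw [hq, Polynomial.coeff_X_pow_mul]; exact hn)
    obtain rfl : n = s := by omega
    exact hs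

instance irrelevantIdeal_isMaximal : (irrelevantIdeal k C).IsMaximal :=
  RingHom.ker_isMaximal_of_surjective _ fun a =>
    ⟨algebraMap k (semigroupRing k C) a, by simp⟩

/-- The homomorphism is x ↦ xh/f; linearity follows by cancelling f. -/
lemma exists_hom_of_dvd {A : Type*} [CommRing A] [IsDomain A] (𝔪 : Ideal A) {f h : A} (hf : f ≠ 0)
    (H : ∀ x ∈ 𝔪, f ∣ x * h) : ∃ φ : 𝔪 →ₗ[A] A, ∀ x, f * φ x = x * h := by
  choose q hq using fun x : 𝔪 => H x x.2
  refine ⟨{ toFun := q, map_add' := fun x y => ?_, map_smul' := fun a x => ?_ }, fun x => (hq x).symm⟩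
  · refine mul_left_cancel₀ hf ?_
    rw [← hq, mul_add, ← hq, ← hq, Submodule.coe_add, add_mul]
  · refine mul_left_cancel₀ hf ?_
    rw [← hq, RingHom.id_apply, smul_eq_mul, mul_left_comm, ← hq, Submodule.coe_smul, smul_eq_mul,
      mul_assoc]

/-- The elements which `𝔪` multiplies into `(t)`. -/
def socleIdeal {A : Type*} [CommRing A] (𝔪 : Ideal A) (t : A) : Ideal A where
  carrier := {h | ∀ x ∈ 𝔪, t ∣ x * h}
  add_mem' := fun {a b} ha hb x hx => by
    rw [mul_add]
    exact dvd_add (ha x hx) (hb x hx)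
  zero_mem' := fun x _ => by simp
  smul_mem' := fun c h hh x hx => by
    rw [smul_eq_mul, mul_left_comm]
    exact (hh x hx).mul_left c

lemma mem_socleIdeal {A : Type*} [CommRing A] {𝔪 : Ideal A} {t h : A} :
    h ∈ socleIdeal 𝔪 t ↔ ∀ x ∈ 𝔪, t ∣ x * h := Iff.rfl

/-- The length of `Ext¹(A ⧸ 𝔪, A)` is the length of the socle of `A ⧸ (t)`, for a nonzero `t ∈ 𝔪`. -/
theorem typeAt_eq_length_of_socle {A : Type u} [CommRing A] [IsDomain A] {V : Type*}
    [AddCommGroup V] [Module A V] (𝔪 : Ideal A) {t : A} (ht : t ∈ 𝔪) (ht0 : t ≠ 0)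
    (θ : socleIdeal 𝔪 t →ₗ[A] V) (hθ : Function.Surjective θ)
    (hker : ∀ h, θ h = 0 ↔ t ∣ (h : A)) : typeAt 𝔪 = Module.length A V := by
  have hcomm : ∀ (φ : 𝔪 →ₗ[A] A) (x : 𝔪), (x : A) * φ ⟨t, ht⟩ = t * φ x := by
    intro φ x
    rw [← smul_eq_mul, ← smul_eq_mul, ← map_smul, ← map_smul]
    congr 1
    ext1
    exact mul_comm _ _
  -- The identity xφ(t) = tφ(x) shows that φ is determined by φ(t). Evaluation at t identifies
  -- Hom(𝔪, A) with (t) : 𝔪 and the multiplications with (t).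
  let ev : (𝔪 →ₗ[A] A) →ₗ[A] socleIdeal 𝔪 t :=
    { toFun := fun φ => ⟨φ ⟨t, ht⟩, fun x hx => ⟨_, hcomm φ ⟨x, hx⟩⟩⟩
      map_add' := fun _ _ => rfl
      map_smul' := fun _ _ => rfl }
  refine typeAt_eq_length 𝔪 (θ ∘ₗ ev) (hθ.comp fun h => ?_) fun φ => ?_
  · obtain ⟨φ, hφ⟩ := exists_hom_of_dvd 𝔪 ht0 (mem_socleIdeal.1 h.2)
    exact ⟨φ, Subtype.ext (mul_left_cancel₀ ht0 (hφ ⟨t, ht⟩))⟩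
  · rw [LinearMap.comp_apply, hker]
    constructor
    · rintro ⟨q, hq⟩
      replace hq : φ ⟨t, ht⟩ = t * q := hq
      refine ⟨q, fun y => mul_left_cancel₀ ht0 ?_⟩
      rw [← hcomm, hq]
      ring
    · rintro ⟨a, ha⟩
      exact ⟨a, (ha _).trans (mul_comm _ _)⟩

/-- The quotient of a ring by an ideal, as a module. -/
abbrev quotientModule {A : Type*} [CommRing A] (I : Ideal A) : Module A (A ⧸ I) := inferInstance

noncomputable instance residueModule :
    Module (semigroupRing k C) (semigroupRing k C ⧸ irrelevantIdeal k C) :=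
  quotientModule _

noncomputable instance residueSMul :
    SMul (semigroupRing k C) (semigroupRing k C ⧸ irrelevantIdeal k C) :=
  residueModule.toSMul

/-- The residue class of a coefficient. -/
noncomputable def residueCoeff (w : ℕ) (h : semigroupRing k C) :
    semigroupRing k C ⧸ irrelevantIdeal k C :=
  Ideal.Quotient.mk _ (algebraMap k (semigroupRing k C) ((h : Polynomial k).coeff w))

lemma sub_algebraMap_mem (a : semigroupRing k C) :
    a - algebraMap k (semigroupRing k C) ((a : Polynomial k).coeff 0) ∈ irrelevantIdeal k C := by
  rw [mem_irrelevantIdeal_iff]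
  simp

lemma residueCoeff_add (w : ℕ) (h h' : semigroupRing k C) :
    residueCoeff w (h + h') = residueCoeff w h + residueCoeff w h' := by
  simp [residueCoeff]

lemma residueCoeff_zero (h : semigroupRing k C) :
    residueCoeff 0 h = Ideal.Quotient.mk _ h := by
  rw [residueCoeff, eq_comm, Ideal.Quotient.eq]
  exact sub_algebraMap_mem h

lemma residueCoeff_eq_zero_iff (w : ℕ) (h : semigroupRing k C) :
    residueCoeff w h = 0 ↔ (h : Polynomial k).coeff w = 0 := by
  rw [residueCoeff, Ideal.Quotient.eq_zero_iff_mem, mem_irrelevantIdeal_iff]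
  simp

/-- Modulo 𝔪 the scalar a is its constant term, and by `H` the difference contributes nothing in
degree w. -/
lemma residueCoeff_smul (w : ℕ) (a h : semigroupRing k C)
    (H : ∀ x ∈ irrelevantIdeal k C, ((x * h : semigroupRing k C) : Polynomial k).coeff w = 0) :
    residueCoeff w (a * h) = a • residueCoeff w h := by
  have h1 := H _ (sub_algebraMap_mem a)
  rw [sub_mul, Subalgebra.coe_sub, Polynomial.coeff_sub, sub_eq_zero] at h1
  have h2 : ((a * h : semigroupRing k C) : Polynomial k).coeff w =
      (a : Polynomial k).coeff 0 * (h : Polynomial k).coeff w := by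
    rw [h1]
    simp
  rw [residueCoeff, h2, map_mul, map_mul]
  change residueCoeff 0 a * residueCoeff w h = _
  rw [residueCoeff_zero]
  rfl

/-- The Cohen–Macaulay type of `k[C]` is the number of maximal elements of the Apéry set of `⟨C⟩`
with respect to a nonzero element `c`. -/
theorem cohenMacaulayType_eq_card (c : ℕ) (hc : c ∈ semigroup C) (hc0 : c ≠ 0) (W : Finset ℕ)
    (hW : ∀ w, w ∈ W ↔ w ∈ semigroup C ∧ (¬ ∃ s ∈ semigroup C, w = c + s) ∧
      ∀ g ∈ semigroup C, g ≠ 0 → ∃ s ∈ semigroup C, w + g = c + s) :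
    cohenMacaulayType k C = W.card := by
  classical
  have hmono : ∀ g : semigroup C, (g : ℕ) ≠ 0 → monomialOf k g ∈ irrelevantIdeal k C := by
    intro g hg
    rw [mem_irrelevantIdeal_iff, coe_monomialOf, Polynomial.coeff_X_pow, if_neg hg.symm]
  let t := monomialOf k (⟨c, hc⟩ : semigroup C)
  have hcoeff : ∀ w ∈ W, ∀ a : semigroupRing k C, t ∣ a → (a : Polynomial k).coeff w = 0 := by
    intro w hw a ha
    by_contra hne
    exact ((hW w).1 hw).2.1 ((monomialOf_dvd_iff _ _).1 ha w hne)
  -- Modulo (t), an element of (t) : 𝔪 is recorded by its coefficients at the exponents in W, so the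
  -- quotient becomes one residue field for each element of W.
  let θ : socleIdeal (irrelevantIdeal k C) t →ₗ[semigroupRing k C]
      (W → semigroupRing k C ⧸ irrelevantIdeal k C) :=
    { toFun := fun h w => residueCoeff w h
      map_add' := fun h h' => funext fun w => residueCoeff_add _ _ _
      map_smul' := fun a h => funext fun w =>
        residueCoeff_smul w a h fun x hx => hcoeff w w.2 _ (mem_socleIdeal.1 h.2 x hx) }
  have hsurj : Function.Surjective θ := by
    intro v
    choose a ha using fun w => Ideal.Quotient.mk_surjective (v w)
    let x : W → k := fun w => (a w : Polynomial k).coeff 0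
    let p : Polynomial k := ∑ w : W, Polynomial.monomial w (x w)
    have hco : ∀ n, p.coeff n = if h : n ∈ W then x ⟨n, h⟩ else 0 := by
      intro n
      simp only [p, Polynomial.finsetSum_coeff, Polynomial.coeff_monomial]
      split_ifs with h
      · rw [Finset.sum_eq_single ⟨n, h⟩]
        · simp
        · intro b _ hb
          rw [if_neg fun e => hb (Subtype.ext e)]
        · simp
      · refine Finset.sum_eq_zero fun b _ => ?_
        rw [if_neg]
        rintro rfl
        exact h b.2
    have hsupp : ∀ n, p.coeff n ≠ 0 → n ∈ W := by
      intro n hn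
      by_contra h
      rw [hco, dif_neg h] at hn
      exact hn rfl
    let h : semigroupRing k C :=
      ⟨p, mem_semigroupRing_iff.2 fun n hn => ((hW n).1 (hsupp n hn)).1⟩
    have hmem : h ∈ socleIdeal (irrelevantIdeal k C) t := by
      intro y hy
      rw [monomialOf_dvd_iff]
      intro n hn
      rw [Subalgebra.coe_mul, Polynomial.coeff_mul] at hn
      obtain ⟨⟨i, j⟩, hij, hne⟩ := Finset.exists_ne_zero_of_sum_ne_zero hn
      rw [Finset.HasAntidiagonal.mem_antidiagonal] at hij
      have hi := left_ne_zero_of_mul hne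
      have hj := right_ne_zero_of_mul hne
      have hi0 : i ≠ 0 := by
        rintro rfl
        exact hi hy
      have := ((hW j).1 (hsupp j hj)).2.2 i (coeff_mem_semigroup y hi) hi0
      rwa [add_comm, hij] at this
    refine ⟨⟨h, hmem⟩, funext fun w => ?_⟩
    change residueCoeff w h = v w
    rw [← ha w, ← residueCoeff_zero, residueCoeff, residueCoeff]
    congr 2
    exact (hco w).trans (dif_pos w.2)
  have hker : ∀ h, θ h = 0 ↔ t ∣ (h : semigroupRing k C) := by
    intro h
    constructor
    · intro H
      rw [monomialOf_dvd_iff]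
      intro n hn
      by_contra hnot
      -- An exponent of h that is not divisible by t is maximal, since multiplying h by any monomial
      -- of 𝔪 lands in (t).
      have hnW : n ∈ W := by
        refine (hW n).2 ⟨coeff_mem_semigroup _ hn, hnot, fun g hg hg0 => ?_⟩
        refine (monomialOf_dvd_iff _ _).1
          (mem_socleIdeal.1 h.2 _ (hmono ⟨g, hg⟩ hg0)) (n + g) ?_
        rw [Subalgebra.coe_mul, coe_monomialOf, Polynomial.coeff_X_pow_mul]
        exact hn
      exact hn ((residueCoeff_eq_zero_iff n _).1 (congrFun H ⟨n, hnW⟩))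
    · intro H
      exact funext fun w => (residueCoeff_eq_zero_iff _ _).2 (hcoeff w w.2 _ H)
  have : IsSimpleModule (semigroupRing k C) (semigroupRing k C ⧸ irrelevantIdeal k C) :=
    isSimpleModule_iff_isCoatom.2 irrelevantIdeal_isMaximal.out
  refine (typeAt_eq_length_of_socle _ (hmono ⟨c, hc⟩ hc0) (monomialOf_ne_zero _) θ hsurj hker).trans
    ?_
  rw [Module.length_pi_of_fintype]
  simp only [Module.length_eq_one]
  simp

end CohenMacaulayType

/-! ### The determinantal ideal and its gluing with one variable -/

section Herzog

universe u

variable {k : Type u} [Field k]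

/-- Herzog's theorem: the toric ideal of three weights with a Herzog presentation is generated by
the maximal minors of a `2 × 3` matrix of monomials. -/
theorem toricIdeal_eq_span_minors {σ : Type*} (e : Fin 4 ≃ σ) {b₁ b₂ b₃ : ℕ} (h₁ : 0 < b₁)
    (h₂ : 0 < b₂) (h₃ : 0 < b₃) (h : HerzogData b₁ b₂ b₃) :
    toricIdeal k e (![(1, 0), (0, b₁), (0, b₂), (0, b₃)] : Fin 4 → ℕ × ℕ) =
      Ideal.span {mono k e ![0, h.r₃₁, h.r₃₂, 0] - mono k e ![0, 0, 0, h.r₁₃ + h.r₂₃],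
        mono k e ![0, 0, h.r₁₂, h.r₁₃] - mono k e ![0, h.r₂₁ + h.r₃₁, 0, 0],
        mono k e ![0, h.r₂₁, 0, h.r₂₃] - mono k e ![0, 0, h.r₁₂ + h.r₃₂, 0]} := by
  set J := Ideal.span {mono k e ![0, h.r₃₁, h.r₃₂, 0] - mono k e ![0, 0, 0, h.r₁₃ + h.r₂₃],
        mono k e ![0, 0, h.r₁₂, h.r₁₃] - mono k e ![0, h.r₂₁ + h.r₃₁, 0, 0],
        mono k e ![0, h.r₂₁, 0, h.r₂₃] - mono k e ![0, 0, h.r₁₂ + h.r₃₂, 0]} with hJ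
  apply le_antisymm
  · apply toricIdeal_le
    let emb : ℕ × ℕ × ℕ →+ (Fin 4 → ℕ) :=
      { toFun := fun v => ![0, v.1, v.2.1, v.2.2]
        map_zero' := by ext i; fin_cases i <;> rfl
        map_add' := fun x y => by ext i; fin_cases i <;> rfl }
    let r : AddCon (ℕ × ℕ × ℕ) := AddCon.comap emb (map_add emb) (idealCon e J)
    have hr : ∀ x y, r x y ↔ idealCon e J (emb x) (emb y) := fun _ _ => Iff.rfl
    have key := h.con_of_weight_eq h₁ h₂ h₃ r
      ((idealCon e J).symm (Ideal.subset_span (by simp [emb])))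
      ((idealCon e J).symm (Ideal.subset_span (by simp [emb])))
      ((idealCon e J).symm (Ideal.subset_span (by simp [emb])))
    intro u v huv
    simp only [weight, Fin.sum_univ_four] at huv
    simp at huv
    have := key _ (u 1) (u 2) (u 3) (v 1) (v 2) (v 3) huv.2 rfl
    rw [hr] at this
    -- The zeroth variable has a weight coordinate of its own, so it occurs to the same power in
    -- both monomials and splits off.
    have h2 := (idealCon e J).add ((idealCon e J).refl ![u 0, 0, 0, 0]) this
    have hu : ![u 0, 0, 0, 0] + emb (u 1, u 2, u 3) = u := by
      ext i; fin_cases i <;> simp [emb]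
    have hv : ![u 0, 0, 0, 0] + emb (v 1, v 2, v 3) = v := by
      ext i; fin_cases i <;> simp [emb, huv.1]
    rwa [hu, hv] at h2
  · rw [hJ, Ideal.span_le]
    rintro _ (rfl | rfl | rfl) <;> rw [SetLike.mem_coe, mono_sub_mono_mem_toricIdeal] <;>
      simp only [weight, Fin.sum_univ_four]
    · simp [h.rel₃]
    · simp [h.rel₁]
    · simp [h.rel₂]

variable {C : Finset ℕ}

lemma isHomogeneous_mono {ι : Type*} [Fintype ι] (e : ι ≃ C) (v : ι → ℕ) :
    IsHomogeneous k C (mono k e v) (weight (fun i => (e i : ℕ)) v) := by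
  rw [mono_eq_prod, weight]
  refine MvPolynomial.IsWeightedHomogeneous.prod _ _ _ fun i _ => ?_
  exact (MvPolynomial.isWeightedHomogeneous_X k _ (e i)).pow _

lemma isHomogeneous_mono_sub_mono {ι : Type*} [Fintype ι] (e : ι ≃ C) {u v : ι → ℕ} {n : ℕ}
    (hu : weight (fun i => (e i : ℕ)) u = n) (hv : weight (fun i => (e i : ℕ)) v = n) :
    IsHomogeneous k C (mono k e u - mono k e v) n := by
  have h1 := isHomogeneous_mono (k := k) e u
  have h2 := isHomogeneous_mono (k := k) e v
  rw [hu] at h1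
  rw [hv] at h2
  exact (MvPolynomial.weightedHomogeneousSubmodule k (fun c : C => (c : ℕ)) n).sub_mem h1 h2

lemma mono_mem_span_X {σ ι : Type*} [Fintype ι] (e : ι ≃ σ) {v : ι → ℕ} {i : ι} (hi : v i ≠ 0) :
    mono k e v ∈ Ideal.span (Set.range (MvPolynomial.X : σ → MvPolynomial σ k)) := by
  classical
  have hX : MvPolynomial.X (e i) ∈
      Ideal.span (Set.range (MvPolynomial.X : σ → MvPolynomial σ k)) :=
    Ideal.subset_span ⟨_, rfl⟩
  refine Ideal.mem_of_dvd _ ?_ hX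
  rw [mono_eq_prod]
  exact (dvd_pow_self _ hi).trans (Finset.dvd_prod_of_mem _ (Finset.mem_univ i))

lemma span_X_le_ker_constantCoeff :
    Ideal.span (Set.range (MvPolynomial.X : C → PolyRing k C)) ≤
      RingHom.ker (MvPolynomial.constantCoeff : PolyRing k C →+* k) := by
  rw [Ideal.span_le]
  rintro _ ⟨c, rfl⟩
  simp [RingHom.mem_ker]

/-- The ideal generated by the maximal minors of a `2 × 3` matrix together with a nonzerodivisor
needs four generators, when all these elements lie in a maximal ideal. -/
theorem spanFinrank_eq_four_of_minors {R : Type*} [CommRing R] [IsDomain R]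
    [UniqueFactorizationMonoid R] (𝔪 : Ideal R) [𝔪.IsMaximal]
    {p₁ p₂ p₃ q₁ q₂ q₃ f₁ f₂ f₃ g : R}
    (r₁ : f₁ = p₂ * q₃ - p₃ * q₂) (r₂ : f₂ = p₃ * q₁ - p₁ * q₃) (r₃ : f₃ = p₁ * q₂ - p₂ * q₁)
    (hne : f₁ ≠ 0) (hrel : ∀ d, d ∣ f₁ → d ∣ f₂ → d ∣ f₃ → IsUnit d)
    (hg : ∀ x, g * x ∈ Ideal.span {f₁, f₂, f₃} → x ∈ Ideal.span {f₁, f₂, f₃})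
    (mp₁ : p₁ ∈ 𝔪) (mp₂ : p₂ ∈ 𝔪) (mp₃ : p₃ ∈ 𝔪) (mq₁ : q₁ ∈ 𝔪) (mq₂ : q₂ ∈ 𝔪) (mq₃ : q₃ ∈ 𝔪)
    (mf₁ : f₁ ∈ 𝔪) (mf₂ : f₂ ∈ 𝔪) (mf₃ : f₃ ∈ 𝔪) (mg : g ∈ 𝔪) :
    (Ideal.span (Set.range ![f₁, f₂, f₃, g])).spanFinrank = 4 := by
  refine spanFinrank_eq_of_syzygies_mem 𝔪 _ fun c hc => ?_
  have hc' : (coneMatrix₁ f₁ f₂ f₃ g).mulVecLin c = 0 := by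
    rw [coneMatrix₁_apply]
    ext i : 1
    fin_cases i
    rw [Fin.sum_univ_four] at hc
    simp at hc ⊢
    linear_combination hc
  -- By exactness, a syzygy is the second matrix applied to a vector, and all entries of that matrix
  -- lie in 𝔪.
  obtain ⟨w, rfl⟩ := (exact_coneMatrix₂_coneMatrix₁ r₁ r₂ r₃ hne hrel hg c).1 hc'
  rw [coneMatrix₂_apply]
  intro i
  fin_cases i
  · exact add_mem (add_mem (Ideal.mul_mem_right _ _ mg) (Ideal.mul_mem_right _ _ mp₁))
      (Ideal.mul_mem_right _ _ mq₁)
  · exact add_mem (add_mem (Ideal.mul_mem_right _ _ mg) (Ideal.mul_mem_right _ _ mp₂))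
      (Ideal.mul_mem_right _ _ mq₂)
  · exact add_mem (add_mem (Ideal.mul_mem_right _ _ mg) (Ideal.mul_mem_right _ _ mp₃))
      (Ideal.mul_mem_right _ _ mq₃)
  · exact neg_mem (add_mem (add_mem (Ideal.mul_mem_right _ _ mf₁) (Ideal.mul_mem_right _ _ mf₂))
      (Ideal.mul_mem_right _ _ mf₃))

set_option maxHeartbeats 1000000 in
/-- The resolution and the number of generators for a variable glued to a semigroup with a Herzog
presentation. -/
theorem resolution_of_herzogData (e : Fin 4 ≃ C) {k₁ k₂ b₁ b₂ b₃ : ℕ} (hk : Nat.Coprime k₁ k₂)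
    (hk₁ : 0 < k₁) (hk₂ : 0 < k₂) (e0 : (e 0 : ℕ) = k₁) (e1 : (e 1 : ℕ) = k₂ * b₁)
    (e2 : (e 2 : ℕ) = k₂ * b₂) (e3 : (e 3 : ℕ) = k₂ * b₃) (h₁ : 0 < b₁) (h₂ : 0 < b₂) (h₃ : 0 < b₃)
    (h : HerzogData b₁ b₂ b₃) (hx : ∃ x y z, k₁ = x * b₁ + y * b₂ + z * b₃) :
    (definingIdeal k C).spanFinrank = 4 ∧
      Nonempty (MinimalGradedFreeResolution k C fun i => [1, 4, 5, 2].getD i 0) := by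
  obtain ⟨x, y, z, hx⟩ := hx
  have hT := toricIdeal_eq_span_minors (k := k) e h₁ h₂ h₃ h
  have hI := definingIdeal_eq_sup (k := k) e hk hk₂ e0 e1 e2 e3 hx
  have hprime : (toricIdeal k e
    (![(1, 0), (0, b₁), (0, b₂), (0, b₃)] : Fin 4 → ℕ × ℕ)).IsPrime := inferInstance
  have hgT : mono k e ![k₂, 0, 0, 0] - mono k e ![0, x, y, z] ∉ toricIdeal k e
      (![(1, 0), (0, b₁), (0, b₂), (0, b₃)] : Fin 4 → ℕ × ℕ) := by
    rw [mono_sub_mono_mem_toricIdeal]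
    simp only [weight, Fin.sum_univ_four]
    simp [hk₂.ne']
  have hunit : ∀ d, (∀ f ∈ toricIdeal k e
      (![(1, 0), (0, b₁), (0, b₂), (0, b₃)] : Fin 4 → ℕ × ℕ), d ∣ f) → IsUnit d :=
    fun d => isUnit_of_dvd_toricIdeal e h₂ h₃
  rw [hT] at hI hprime hgT hunit
  set f₁ := mono k e ![0, h.r₃₁, h.r₃₂, 0] - mono k e ![0, 0, 0, h.r₁₃ + h.r₂₃] with hf₁
  set f₂ := mono k e ![0, 0, h.r₁₂, h.r₁₃] - mono k e ![0, h.r₂₁ + h.r₃₁, 0, 0] with hf₂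
  set f₃ := mono k e ![0, h.r₂₁, 0, h.r₂₃] - mono k e ![0, 0, h.r₁₂ + h.r₃₂, 0] with hf₃
  set g := mono k e ![k₂, 0, 0, 0] - mono k e ![0, x, y, z] with hg
  have hI' : definingIdeal k C = Ideal.span {f₁, f₂, f₃, g} := by
    rw [hI, ← Ideal.span_union]
    congr 1
    ext f
    simp
    tauto
  -- The rows are p = (x₁^r₂₁, x₂^r₃₂, x₃^r₁₃) and q = (x₂^r₁₂, x₃^r₂₃, x₁^r₃₁). The signs of the
  -- binomials are chosen so that f = p × q.
  have r₁ : f₁ = mono k e ![0, 0, h.r₃₂, 0] * mono k e ![0, h.r₃₁, 0, 0] -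
      mono k e ![0, 0, 0, h.r₁₃] * mono k e ![0, 0, 0, h.r₂₃] := by
    rw [hf₁, ← mono_add, ← mono_add]
    simp
  have r₂ : f₂ = mono k e ![0, 0, 0, h.r₁₃] * mono k e ![0, 0, h.r₁₂, 0] -
      mono k e ![0, h.r₂₁, 0, 0] * mono k e ![0, h.r₃₁, 0, 0] := by
    rw [hf₂, ← mono_add, ← mono_add]
    simp
  have r₃ : f₃ = mono k e ![0, h.r₂₁, 0, 0] * mono k e ![0, 0, 0, h.r₂₃] -
      mono k e ![0, 0, h.r₃₂, 0] * mono k e ![0, 0, h.r₁₂, 0] := by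
    rw [hf₃, ← mono_add, ← mono_add]
    simp [add_comm]
  have hne : f₁ ≠ 0 := by
    rw [hf₁, sub_ne_zero]
    intro he
    simpa [h.pos₃₁.ne'] using congrFun (mono_injective e he) 1
  have hrel : ∀ d, d ∣ f₁ → d ∣ f₂ → d ∣ f₃ → IsUnit d := by
    intro d d₁ d₂ d₃
    refine hunit d fun f hf => ?_
    rw [← Ideal.mem_span_singleton]
    refine (Ideal.span_le.2 ?_ : Ideal.span {f₁, f₂, f₃} ≤ _) hf
    rintro _ (rfl | rfl | rfl) <;> rw [SetLike.mem_coe, Ideal.mem_span_singleton] <;> assumption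
  have hgreg : ∀ x, g * x ∈ Ideal.span {f₁, f₂, f₃} → x ∈ Ideal.span {f₁, f₂, f₃} :=
    fun x hx => (hprime.mem_or_mem hx).resolve_left hgT
  have hxyz : x ≠ 0 ∨ y ≠ 0 ∨ z ≠ 0 := by
    by_contra! hc
    obtain ⟨rfl, rfl, rfl⟩ := hc
    omega
  have mp₁ := mono_mem_span_X (k := k) e (v := ![0, h.r₂₁, 0, 0]) (i := 1) h.pos₂₁.ne'
  have mp₂ := mono_mem_span_X (k := k) e (v := ![0, 0, h.r₃₂, 0]) (i := 2) h.pos₃₂.ne'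
  have mp₃ := mono_mem_span_X (k := k) e (v := ![0, 0, 0, h.r₁₃]) (i := 3) h.pos₁₃.ne'
  have mq₁ := mono_mem_span_X (k := k) e (v := ![0, 0, h.r₁₂, 0]) (i := 2) h.pos₁₂.ne'
  have mq₂ := mono_mem_span_X (k := k) e (v := ![0, 0, 0, h.r₂₃]) (i := 3) h.pos₂₃.ne'
  have mq₃ := mono_mem_span_X (k := k) e (v := ![0, h.r₃₁, 0, 0]) (i := 1) h.pos₃₁.ne'
  have mf₁ : f₁ ∈ Ideal.span (Set.range (MvPolynomial.X : C → PolyRing k C)) := by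
    rw [r₁]; exact sub_mem (Ideal.mul_mem_left _ _ mq₃) (Ideal.mul_mem_left _ _ mq₂)
  have mf₂ : f₂ ∈ Ideal.span (Set.range (MvPolynomial.X : C → PolyRing k C)) := by
    rw [r₂]; exact sub_mem (Ideal.mul_mem_left _ _ mq₁) (Ideal.mul_mem_left _ _ mq₃)
  have mf₃ : f₃ ∈ Ideal.span (Set.range (MvPolynomial.X : C → PolyRing k C)) := by
    rw [r₃]; exact sub_mem (Ideal.mul_mem_left _ _ mq₂) (Ideal.mul_mem_left _ _ mq₁)
  have mg : g ∈ Ideal.span (Set.range (MvPolynomial.X : C → PolyRing k C)) := by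
    refine sub_mem (mono_mem_span_X e (i := 0) hk₂.ne') ?_
    rcases hxyz with hh | hh | hh
    · exact mono_mem_span_X e (i := 1) hh
    · exact mono_mem_span_X e (i := 2) hh
    · exact mono_mem_span_X e (i := 3) hh
  have hw : ∀ v : Fin 4 → ℕ, weight (fun i => (e i : ℕ)) v =
      v 0 * k₁ + v 1 * (k₂ * b₁) + v 2 * (k₂ * b₂) + v 3 * (k₂ * b₃) := by
    intro v
    simp [weight, Fin.sum_univ_four, e0, e1, e2, e3]
  have w₁ := congrArg (Nat.cast : ℕ → ℤ) h.rel₁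
  have w₂ := congrArg (Nat.cast : ℕ → ℤ) h.rel₂
  have w₃ := congrArg (Nat.cast : ℕ → ℤ) h.rel₃
  have w₀ := congrArg (Nat.cast : ℕ → ℤ) hx
  push_cast at w₀ w₁ w₂ w₃
  have d₁ : IsHomogeneous k C f₁ ((h.r₁₃ + h.r₂₃) * (k₂ * b₃)) := by
    refine isHomogeneous_mono_sub_mono e ?_ ?_ <;> rw [hw] <;> simp
    zify; linear_combination -k₂ * w₃
  have d₂ : IsHomogeneous k C f₂ ((h.r₂₁ + h.r₃₁) * (k₂ * b₁)) := by
    refine isHomogeneous_mono_sub_mono e ?_ ?_ <;> rw [hw] <;> simp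
    zify; linear_combination -k₂ * w₁
  have d₃ : IsHomogeneous k C f₃ ((h.r₁₂ + h.r₃₂) * (k₂ * b₂)) := by
    refine isHomogeneous_mono_sub_mono e ?_ ?_ <;> rw [hw] <;> simp
    zify; linear_combination -k₂ * w₂
  have d₀ : IsHomogeneous k C g (k₂ * k₁) := by
    refine isHomogeneous_mono_sub_mono e ?_ ?_ <;> rw [hw] <;> simp
    zify; linear_combination -k₂ * w₀
  clear_value f₁ f₂ f₃ g
  constructor
  · have hrange : definingIdeal k C = Ideal.span (Set.range ![f₁, f₂, f₃, g]) := by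
      rw [hI']
      congr 1
      ext f
      simp
      tauto
    have : (RingHom.ker (MvPolynomial.constantCoeff : PolyRing k C →+* k)).IsMaximal :=
      constantCoeff_ker_isMaximal
    have hle := span_X_le_ker_constantCoeff (k := k) (C := C)
    rw [hrange]
    exact spanFinrank_eq_four_of_minors (RingHom.ker (MvPolynomial.constantCoeff : PolyRing k C →+* k)) r₁ r₂ r₃ hne hrel
      hgreg (hle mp₁) (hle mp₂) (hle mp₃) (hle mq₁) (hle mq₂) (hle mq₃) (hle mf₁) (hle mf₂)
      (hle mf₃) (hle mg)
  -- `m` and `m'` are the degrees of the syzygies p and q: along each row, entry degree plus minor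
  -- degree is constant by the three Herzog relations.
  · refine ⟨resolutionOfMinors r₁ r₂ r₃ hne hrel hgreg hI' (isHomogeneous_mono e _)
      (isHomogeneous_mono e _) (isHomogeneous_mono e _) (isHomogeneous_mono e _)
      (isHomogeneous_mono e _) (isHomogeneous_mono e _)
      d₁ d₂ d₃ d₀ (m := k₂ * ((h.r₂₁ + h.r₃₁) * b₁ + h.r₃₂ * b₂))
      (m' := k₂ * ((h.r₂₁ + h.r₃₁) * b₁ + h.r₂₃ * b₃)) ?_ ?_ ?_⟩
    · simp only [hw]
      simp
      refine ⟨?_, ?_, ?_⟩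
      · zify; linear_combination -k₂ * w₃
      · ring
      · zify; linear_combination k₂ * w₁
    · simp only [hw]
      simp
      refine ⟨?_, ?_, ?_⟩
      · zify; linear_combination k₂ * w₁
      · ring
      · zify; linear_combination -k₂ * w₂
    · simp only [Set.mem_insert_iff, Set.mem_singleton_iff, forall_eq_or_imp, forall_eq]
      exact ⟨mp₁, mp₂, mp₃, mq₁, mq₂, mq₃, mf₁, mf₂, mf₃, mg⟩

end Herzog

/-! ### Membership in semigroups through generators -/

section Semigroup

lemma mem_semigroup_insert {a n : ℕ} {B : Finset ℕ} :
    n ∈ semigroup (insert a B) ↔ ∃ m, ∃ t ∈ semigroup B, n = a * m + t := by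
  rw [semigroup, Finset.coe_insert, Set.insert_eq, AddSubmonoid.closure_union,
    AddSubmonoid.mem_sup]
  constructor
  · rintro ⟨y, hy, t, ht, rfl⟩
    obtain ⟨m, rfl⟩ := AddSubmonoid.mem_closure_singleton.1 hy
    exact ⟨m, t, ht, by rw [smul_eq_mul, mul_comm]⟩
  · rintro ⟨m, t, ht, rfl⟩
    exact ⟨a * m, AddSubmonoid.mem_closure_singleton.2 ⟨m, by rw [smul_eq_mul, mul_comm]⟩, t, ht,
      rfl⟩

lemma mem_semigroup_singleton {a n : ℕ} : n ∈ semigroup {a} ↔ ∃ m, n = m * a := by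
  rw [semigroup, Finset.coe_singleton, AddSubmonoid.mem_closure_singleton]
  exact exists_congr fun m => by rw [smul_eq_mul, eq_comm]

lemma mem_semigroup_pair {a b n : ℕ} : n ∈ semigroup {a, b} ↔ ∃ x y, n = x * a + y * b := by
  rw [mem_semigroup_insert]
  constructor
  · rintro ⟨x, t, ht, rfl⟩
    obtain ⟨y, rfl⟩ := mem_semigroup_singleton.1 ht
    exact ⟨x, y, by ring⟩
  · rintro ⟨x, y, rfl⟩
    exact ⟨x, _, mem_semigroup_singleton.2 ⟨y, rfl⟩, by ring⟩

lemma mem_semigroup_triple {a b c n : ℕ} :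
    n ∈ semigroup {a, b, c} ↔ ∃ x y z, n = x * a + y * b + z * c := by
  rw [mem_semigroup_insert]
  constructor
  · rintro ⟨x, t, ht, rfl⟩
    obtain ⟨y, z, rfl⟩ := mem_semigroup_pair.1 ht
    exact ⟨x, y, z, by ring⟩
  · rintro ⟨x, y, z, rfl⟩
    exact ⟨x, _, mem_semigroup_pair.2 ⟨y, z, rfl⟩, by ring⟩

lemma mem_semigroup_image {a n : ℕ} {B : Finset ℕ} :
    n ∈ semigroup (B.image fun b => a * b) ↔ ∃ t ∈ semigroup B, n = a * t := by
  have := AddMonoidHom.map_mclosure (AddMonoidHom.mulLeft a) (B : Set ℕ)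
  rw [semigroup, Finset.coe_image,
    show (fun b => a * b) '' (B : Set ℕ) = AddMonoidHom.mulLeft a '' (B : Set ℕ) from rfl, ← this,
    AddSubmonoid.mem_map]
  exact exists_congr fun t => and_congr_right fun _ => eq_comm

/-- Divisibility conditions over a semigroup can be tested on its generators. -/
lemma forall_exists_add_iff {B : Finset ℕ} (hB : ∀ g ∈ B, g ≠ 0) {w c : ℕ} :
    (∀ g ∈ semigroup B, g ≠ 0 → ∃ s ∈ semigroup B, w + g = c + s) ↔
      ∀ g ∈ B, ∃ s ∈ semigroup B, w + g = c + s := by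
  refine ⟨fun h g hg => h g (AddSubmonoid.subset_closure hg) (hB g hg), fun h g hg => ?_⟩
  induction hg using AddSubmonoid.closure_induction with
  | mem g hg => exact fun _ => h g hg
  | zero => exact fun h => absurd rfl h
  | add a b ha hb iha ihb =>
    intro hab
    by_cases h0 : a = 0
    · rw [h0, zero_add] at hab ⊢
      exact ihb hab
    · obtain ⟨s, hs, e⟩ := iha h0
      exact ⟨s + b, add_mem hs hb, by omega⟩

end Semigroup

/-! ### The type of the glued semigroup -/

section Herzog

universe u

variable {k : Type u} [Field k]

/-- The Cohen-Macaulay type for a variable glued to a semigroup with a Herzog presentation. -/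
theorem cohenMacaulayType_of_herzogData {k₁ k₂ b₁ b₂ b₃ : ℕ} (hk : Nat.Coprime k₁ k₂)
    (hk₁ : 0 < k₁) (hk₂ : 0 < k₂) (h₁ : 0 < b₁) (h₂ : 0 < b₂) (h₃ : 0 < b₃)
    (h : HerzogData b₁ b₂ b₃) (hx : k₁ ∈ semigroup {b₁, b₂, b₃}) :
    cohenMacaulayType k (insert k₁ (Finset.image (fun b => k₂ * b) {b₁, b₂, b₃})) = 2 := by
  set C := insert k₁ (Finset.image (fun b => k₂ * b) {b₁, b₂, b₃}) with hC
  have hS : ∀ n, n ∈ semigroup C ↔ ∃ m, ∃ t ∈ semigroup {b₁, b₂, b₃}, n = k₁ * m + k₂ * t := by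
    intro n
    rw [hC, mem_semigroup_insert]
    simp only [mem_semigroup_image]
    constructor
    · rintro ⟨m, _, ⟨t, ht, rfl⟩, rfl⟩
      exact ⟨m, t, ht, rfl⟩
    · rintro ⟨m, t, ht, rfl⟩
      exact ⟨m, _, ⟨t, ht, rfl⟩, rfl⟩
  have m₁ : b₁ ∈ semigroup {b₁, b₂, b₃} := AddSubmonoid.subset_closure (by simp)
  have m₂ : b₂ ∈ semigroup {b₁, b₂, b₃} := AddSubmonoid.subset_closure (by simp)
  have m₃ : b₃ ∈ semigroup {b₁, b₂, b₃} := AddSubmonoid.subset_closure (by simp)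
  -- k₁ is a nonzero element of the semigroup, so its condition follows from those of the
  -- generators, and the one for b₁ holds trivially.
  have hkG : ∀ v ∈ semigroup {b₁, b₂, b₃},
      (∀ g ∈ ({b₂, b₃} : Set ℕ), ∃ t ∈ semigroup {b₁, b₂, b₃}, v + g = b₁ + t) →
      ∃ t ∈ semigroup {b₁, b₂, b₃}, v + k₁ = b₁ + t := by
    intro v hv hg
    refine (forall_exists_add_iff (by simp; omega)).2 ?_ k₁ hx hk₁.ne'
    simp only [Finset.mem_insert, Finset.mem_singleton, forall_eq_or_imp, forall_eq]
    exact ⟨⟨v, hv, add_comm _ _⟩, hg b₂ (by simp), hg b₃ (by simp)⟩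
  have key := maximal_apery_gluing_iff (b := b₁) hk hk₂ (semigroup {b₁, b₂, b₃}) hx
    (semigroup C) hS {b₂, b₃} (by rintro g (rfl | rfl) <;> assumption) hkG
  have hinj : k₂ * h.apery₁ + (k₂ - 1) * k₁ ≠ k₂ * h.apery₂ + (k₂ - 1) * k₁ := by
    intro he
    exact h.apery₁_ne_apery₂ (Nat.eq_of_mul_eq_mul_left hk₂ (Nat.add_right_cancel he))
  rw [cohenMacaulayType_eq_card (k₂ * b₁) ((hS _).2 ⟨0, b₁, m₁, by simp⟩) (by positivity)
    {k₂ * h.apery₁ + (k₂ - 1) * k₁, k₂ * h.apery₂ + (k₂ - 1) * k₁}, Finset.card_pair hinj]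
  · rfl
  intro w
  have hgen : (∀ g ∈ semigroup C, g ≠ 0 → ∃ s ∈ semigroup C, w + g = k₂ * b₁ + s) ↔
      ∀ g ∈ C, ∃ s ∈ semigroup C, w + g = k₂ * b₁ + s := by
    refine forall_exists_add_iff ?_
    simp [hC]
    omega
  have hmax := fun v => h.maximal_apery_iff h₁ h₂ h₃ (semigroup {b₁, b₂, b₃})
    (fun n => mem_semigroup_triple) v
  rw [hgen]
  have key' := key w
  simp only [SetLike.mem_coe, Set.mem_insert_iff, Set.mem_singleton_iff, forall_eq_or_imp,
    forall_eq] at key' hmax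
  simp only [hmax] at key'
  rw [show w ∈ ({k₂ * h.apery₁ + (k₂ - 1) * k₁, k₂ * h.apery₂ + (k₂ - 1) * k₁} : Finset ℕ) ↔
      ∃ v, (v = h.apery₁ ∨ v = h.apery₂) ∧ w = k₂ * v + (k₂ - 1) * k₁ by simp [or_and_right,
        exists_or], ← key']
  refine and_congr_right fun hw => and_congr_right fun _ => ?_
  simp only [hC, Finset.image_insert, Finset.image_singleton, Finset.mem_insert,
    Finset.mem_singleton, forall_eq_or_imp, forall_eq]
  -- The condition for the generator k₂b₁ holds with s = w, so it can be dropped.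
  refine and_congr_right fun _ => (and_iff_right ⟨w, ?_, add_comm _ _⟩).symm
  simpa only [hC, Finset.image_insert, Finset.image_singleton] using hw

end Herzog

/-! ### The shapes 1+3 and 2+2 -/

section Decomposable

universe u

variable {k : Type u} [Field k] {C : Finset ℕ}

lemma exists_equiv_of_forall_mem {n : ℕ} (hcard : C.card = n) (f : Fin n → ℕ) (hf : ∀ i, f i ∈ C)
    (hsurj : ∀ c ∈ C, ∃ i, f i = c) : ∃ e : Fin n ≃ C, ∀ i, (e i : ℕ) = f i := by
  have hbij : Function.Bijective (fun i => (⟨f i, hf i⟩ : C)) := by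
    rw [Fintype.bijective_iff_surjective_and_card]
    refine ⟨?_, by simp [hcard]⟩
    rintro ⟨c, hc⟩
    obtain ⟨i, hi⟩ := hsurj c hc
    exact ⟨i, Subtype.ext hi⟩
  exact ⟨Equiv.ofBijective _ hbij, fun i => rfl⟩

/-- The conclusion for a variable glued to a semigroup with three generators. -/
theorem isCompleteIntersection_or_of_gluing_one_three {k₁ k₂ b₁ b₂ b₃ : ℕ}
    (hC : C = insert k₁ (Finset.image (fun b => k₂ * b) {b₁, b₂, b₃})) (hcard : C.card = 4)
    (hk : Nat.Coprime k₁ k₂) (hk₁ : 0 < k₁) (hk₂ : 0 < k₂) (h₁ : 0 < b₁) (h₂ : 0 < b₂)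
    (h₃ : 0 < b₃) (hb : Nat.gcd (Nat.gcd b₁ b₂) b₃ = 1) (hx : k₁ ∈ semigroup {b₁, b₂, b₃}) :
    IsCompleteIntersection k C ∨
      (IsAlmostCompleteIntersection k C ∧ cohenMacaulayType k C = 2 ∧
        Nonempty (MinimalGradedFreeResolution k C fun i => [1, 4, 5, 2].getD i 0)) := by
  have hpos : ∀ c ∈ C, 0 < c := by
    simp [hC, hk₁, hk₂, h₁, h₂, h₃]
  obtain ⟨x, y, z, hxyz⟩ := mem_semigroup_triple.1 hx
  -- In the gluing cases the generators are renumbered so that the one glued to the other two comes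
  -- last.
  rcases gluing_or_herzogData h₁ h₂ h₃ with hg | hg | hg | h
  · obtain ⟨e, he⟩ := exists_equiv_of_forall_mem hcard ![k₁, k₂ * b₁, k₂ * b₂, k₂ * b₃]
      (by simp [Fin.forall_fin_succ, hC]) (by simp [Fin.exists_fin_succ, hC])
    exact .inl (isCompleteIntersection_of_gluing_one_three e hk hk₂ (he 0) (he 1) (he 2) (he 3)
      h₁ h₂ h₃ hb ⟨x, y, z, hxyz⟩ hg)
  · obtain ⟨e, he⟩ := exists_equiv_of_forall_mem hcard ![k₁, k₂ * b₁, k₂ * b₃, k₂ * b₂]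
      (by simp [Fin.forall_fin_succ, hC]) (by simp [Fin.exists_fin_succ, hC])
    exact .inl (isCompleteIntersection_of_gluing_one_three e hk hk₂ (he 0) (he 1) (he 2) (he 3)
      h₁ h₃ h₂ (by rwa [Nat.gcd_right_comm]) ⟨x, z, y, by omega⟩ hg)
  · obtain ⟨e, he⟩ := exists_equiv_of_forall_mem hcard ![k₁, k₂ * b₂, k₂ * b₃, k₂ * b₁]
      (by simp [Fin.forall_fin_succ, hC]) (by simp [Fin.exists_fin_succ, hC])
    exact .inl (isCompleteIntersection_of_gluing_one_three e hk hk₂ (he 0) (he 1) (he 2) (he 3)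
      h₂ h₃ h₁ (by rwa [Nat.gcd_comm, ← Nat.gcd_assoc]) ⟨y, z, x, by omega⟩ hg)
  · obtain ⟨h⟩ := h
    right
    obtain ⟨e, he⟩ := exists_equiv_of_forall_mem hcard ![k₁, k₂ * b₁, k₂ * b₂, k₂ * b₃]
      (by simp [Fin.forall_fin_succ, hC]) (by simp [Fin.exists_fin_succ, hC])
    obtain ⟨hrank, hres⟩ := resolution_of_herzogData (k := k) e hk hk₁ hk₂ (he 0) (he 1) (he 2)
      (he 3) h₁ h₂ h₃ h ⟨x, y, z, hxyz⟩
    refine ⟨?_, ?_, hres⟩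
    · rw [IsAlmostCompleteIntersection, hrank, height_definingIdeal hpos e]
      rfl
    · rw [hC]
      exact cohenMacaulayType_of_herzogData hk hk₁ hk₂ h₁ h₂ h₃ h hx

lemma IsMinimalGeneratingSet.card_pos {A : Finset ℕ} (hA : IsMinimalGeneratingSet A) :
    0 < A.card := by
  rw [Finset.card_pos, Finset.nonempty_iff_ne_empty]
  rintro rfl
  simpa using hA.gcd_eq_one

lemma IsMinimalGeneratingSet.eq_one_of_card {A : Finset ℕ} (hA : IsMinimalGeneratingSet A)
    (h : A.card = 1) : A = {1} := by
  obtain ⟨a, rfl⟩ := Finset.card_eq_one.1 h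
  simpa using hA.gcd_eq_one

/-- The conclusion for a gluing whose first part has at most as many generators as the second. -/
theorem isCompleteIntersection_or_of_gluing {A B : Finset ℕ} {k₁ k₂ : ℕ}
    (hA : IsMinimalGeneratingSet A) (hB : IsMinimalGeneratingSet B) (hcard : C.card = 4)
    (hk₁ : 0 < k₁) (hk₂ : 0 < k₂) (hk : Nat.Coprime k₁ k₂) (hkB : k₁ ∈ semigroup B)
    (hkA : k₂ ∈ semigroup A)
    (hC : C = (A.image fun a => k₁ * a) ∪ (B.image fun b => k₂ * b))
    (hAB : A.card + B.card = 4) (hle : A.card ≤ B.card) :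
    IsCompleteIntersection k C ∨
      (IsAlmostCompleteIntersection k C ∧ cohenMacaulayType k C = 2 ∧
        Nonempty (MinimalGradedFreeResolution k C fun i => [1, 4, 5, 2].getD i 0)) := by
  have hApos := hA.card_pos
  obtain hA1 | hA2 : A.card = 1 ∨ A.card = 2 := by omega
  · obtain rfl := hA.eq_one_of_card hA1
    obtain ⟨b₁, b₂, b₃, -, -, -, rfl⟩ := Finset.card_eq_three.1 (show B.card = 3 by omega)
    refine isCompleteIntersection_or_of_gluing_one_three ?_ hcard hk hk₁ hk₂ (hB.pos _ (by simp))
      (hB.pos _ (by simp)) (hB.pos _ (by simp)) ?_ hkB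
    · rw [hC, Finset.image_singleton, mul_one, Finset.singleton_union]
    · simpa [Finset.gcd_insert, Nat.gcd_assoc, gcd_eq_nat_gcd] using hB.gcd_eq_one
  · obtain ⟨a₁, a₂, -, rfl⟩ := Finset.card_eq_two.1 hA2
    obtain ⟨b₁, b₂, -, rfl⟩ := Finset.card_eq_two.1 (show B.card = 2 by omega)
    obtain ⟨e, he⟩ := exists_equiv_of_forall_mem hcard ![k₂ * b₁, k₁ * a₁, k₁ * a₂, k₂ * b₂]
      (by simp [Fin.forall_fin_succ, hC])
      (by simp [Fin.exists_fin_succ, hC])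
    exact .inl (isCompleteIntersection_of_gluing_two_two e hk hk₂
      (by simpa [Finset.gcd_insert, gcd_eq_nat_gcd] using hA.gcd_eq_one)
      (by simpa [Finset.gcd_insert, gcd_eq_nat_gcd] using hB.gcd_eq_one) (hA.pos _ (by simp)) (hB.pos _ (by simp))
      (he 0) (he 1) (he 2) (he 3) (mem_semigroup_pair.1 hkB) (mem_semigroup_pair.1 hkA))

end Decomposable

end NumSemi

/-- A decomposable numerical semigroup of embedding dimension `4` is a complete intersection, or an
almost complete intersection of Cohen-Macaulay type `2` whose semigroup ring has a minimal graded
free resolution of the form `0 → R² → R⁵ → R⁴ → R → k[C] → 0`. -/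
theorem proposition5p1 {k : Type*} [Field k] (C : Finset ℕ)
    (hC : NumSemi.IsMinimalGeneratingSet C) (hcard : C.card = 4)
    (hdec : NumSemi.IsDecomposable C) :
    NumSemi.IsCompleteIntersection k C ∨
      (NumSemi.IsAlmostCompleteIntersection k C ∧
        NumSemi.cohenMacaulayType k C = 2 ∧
        Nonempty (NumSemi.MinimalGradedFreeResolution k C fun i => [1, 4, 5, 2].getD i 0)) := by
  obtain ⟨A, B, k₁, k₂, hA, hB, hk₁, hk₂, hk, hkB, -, hkA, -, hdisj, hAB⟩ := hdec
  have hsum : A.card + B.card = 4 := by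
    rw [← hcard, hAB, Finset.card_union_of_disjoint hdisj,
      Finset.card_image_of_injective _ (mul_right_injective₀ hk₁.ne'),
      Finset.card_image_of_injective _ (mul_right_injective₀ hk₂.ne')]
  -- The hypotheses are symmetric under exchanging (A, k₁) with (B, k₂), so the smaller part may
  -- come first.
  rcases le_total A.card B.card with hle | hle
  · exact NumSemi.isCompleteIntersection_or_of_gluing hA hB hcard hk₁ hk₂ hk hkB hkA hAB hsum hle
  · exact NumSemi.isCompleteIntersection_or_of_gluing hB hA hcard hk₂ hk₁ hk.symm hkA hkB
      (hAB.trans (Finset.union_comm _ _)) ((add_comm _ _).trans hsum) hle
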